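/- Let $k,n,q\ge 0$ be integers, let $\Sigma$ be a finite alphabet and let $\delta,\varepsilon>0$. A code $\mathsf C\colon\{0,1\}^k\to\Sigma^n$ is a $(q,\delta,\varepsilon)$-locally decodable code (a $(q,\delta,\varepsilon)$-LDC) if there is a randomized decoding algorithm $\mathrm{Dec}$ which, given an input $i\in[k]$ and oracle access to a string $y\in\Sigma^n$, makes at most $q$ (possibly adaptive) queries to coordinates of $y$ and outputs a bit, such that for all $b\in\{0,1\}^k$, all $i\in[k]$ and all $y\in\Sigma^n$ with $|\{v\in[n]: y_v\neq \mathsf C(b)_v\}|\le\delta n$, $$\Pr[\mathrm{Dec}^y(i)=b_i]\ \ge\ \tfrac12+\varepsilon .$$ Theorem. (1) There is an absolute constant $K>0$ such that for every finite alphabet $\Sigma$, all $k,n$, all $\delta,\varepsilon>0$ and every $(3,\delta,\varepsilon)$-LDC $\mathsf C\colon\{0,1\}^k\to\Sigma^n$, $$k^3\ \le\ |\Sigma|^{41}\, n\cdot K\,\frac{\log^6(|\Sigma|\, n)}{\varepsilon^{32}\,\delta^{16}} ,$$ where the logarithm is read as $0$ when $|\Sigma|\,n=0$ (which is possible only for $k=0$).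 (2) In particular, for all $\delta,\varepsilon>0$ there is a constant $c>0$, depending only on $\delta$ and $\varepsilon$, such that for all $k\ge 2$, all $n$, every alphabet $\Sigma$ with $|\Sigma|\le n$ and every $(3,\delta,\varepsilon)$-LDC $\mathsf C\colon\{0,1\}^k\to\Sigma^n$, $$n\ \ge\ c\cdot\frac{k^3}{|\Sigma|^{41}\log^6 k} .$$ -/

import Mathlib

universe u

/-- A deterministic (adaptive) decoding procedure with oracle access to a string of length `n` over
the alphabet `A`, making at most `q` queries: it either stops and outputs a bit, or queries one
coordinate and continues, depending on the symbol it reads, with at most one query fewer. -/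
inductive QueryTree (A : Type u) (n : ℕ) : ℕ → Type u
  | output {q : ℕ} (bit : Bool) : QueryTree A n q
  | query {q : ℕ} (v : Fin n) (next : A → QueryTree A n q) : QueryTree A n (q + 1)

/-- The bit that the procedure outputs when its oracle is the string `y`. -/
def QueryTree.run {A : Type u} {n : ℕ} (y : Fin n → A) : {q : ℕ} → QueryTree A n q → Bool
  | _, .output bit => bit
  | _, .query v next => (next (y v)).run y

/-- The distribution of the output, on the oracle `y`, of a randomized procedure making at most `q`
queries. The procedure is a probability distribution over deterministic ones: all its coins are
tossed in advance. -/
noncomputable def outputLaw {A : Type u} {n q : ℕ} (dec : PMF (QueryTree A n q)) (y : Fin n → A) :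
    PMF Bool :=
  dec.map (QueryTree.run y)

/-- The code `C : {0,1}^k → A^n` is `(q, δ, ε)`-locally decodable. -/
def IsLDC {A : Type u} [DecidableEq A] {k n : ℕ} (q : ℕ) (δ ε : ℝ)
    (C : (Fin k → Bool) → (Fin n → A)) : Prop :=
  ∃ dec : Fin k → PMF (QueryTree A n q),
    ∀ (b : Fin k → Bool) (i : Fin k) (y : Fin n → A),
      (hammingDist y (C b) : ℝ) ≤ δ * n →
        1 / 2 + ε ≤ (outputLaw (dec i) y (b i)).toReal

/-! Guessing the answers turns an adaptive decoder for bit `i` into a polynomial. Each of the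
`|A|^3` guesses fixes three query positions, and exactly one guess agrees with the oracle, so the
mean output sign is a cubic form in the symbol indicators of the word (`sum_guess_eq`). At most `δ
n` coordinates are queried too often over all guesses, and overwriting them by a fixed symbol is a
corruption that the decoder tolerates. After scaling, bit `i` has a tensor `T i` on `V`, with `N =
n(|A|+1)` points, whose slices have absolute sum at most one and whose signed value at every
codeword is at least `2εδn/(3|A|^3)` (`exists_tensor_of_decoder`). Hence the average over `b` of the
sum of `b_i T_i(x_b, x_b, x_b)` is at least `η k N`, and it remains to show that this forces `k^3 ≤
10^27 N L^5/η^10`, where `L` is logarithmic (`card_pow_three_le_of_signedForm`).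

The basic upper bound is for Rademacher sums of matrices. Every sign monomial has nonnegative mean,
so a trace moment of the sum is at most the dimension times a moment of `D` times the scalar sum of
the signs, where `D` bounds row and column sums. In dimension `e^L` this gives norm of order `D
√(kL)`, even when the test vectors depend on the signs (`expect_rademacher_bilinear_le`).

Pairs `(u,v)` or `(u,w)` carrying large total weight are few, so a flattening to a matrix handles
them. On the light rest, Cauchy–Schwarz in `u` and a random cut of the indices produce a Rademacher
sum of 4-tensors (`expect_cut_le`). Its Kikuchi matrix on pairs of `l`-tuples has dimension
`N^(2l)`. Lightness and Chernoff bounds keep nearly all degrees of the order of the mean `k l^2/N`,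
as soon as that mean exceeds about `L^3/η^2` (`expect_rademacher_four_tensor_le`). The spectral
bound is too small for the assumed correlation when `l L` is a small multiple of `η^4 k`. Both
conditions on `l` can be met once `k^3` exceeds `N L^5/η^10` by a large constant factor. -/

open Finset
open scoped BigOperators

/-! ### Sign monomials and moments of scalar Rademacher sums. -/

/-- The sign `±1` attached to a bit. -/
noncomputable def boolSign (b : Bool) : ℝ := if b then 1 else -1

/-- The monomial in the signs of `b` with exponent vector `e`. -/
noncomputable def signMonomial {ι : Type*} [Fintype ι] (e : ι → ℕ) (b : ι → Bool) : ℝ :=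
  ∏ i, boolSign (b i) ^ e i

theorem signMonomial_add {ι : Type*} [Fintype ι] (e f : ι → ℕ) (b : ι → Bool) :
    signMonomial (e + f) b = signMonomial e b * signMonomial f b := by
  simp [signMonomial, pow_add, Finset.prod_mul_distrib]

theorem signMonomial_zero {ι : Type*} [Fintype ι] (b : ι → Bool) :
    signMonomial (0 : ι → ℕ) b = 1 := by
  simp [signMonomial]

theorem signMonomial_single {ι : Type*} [Fintype ι] [DecidableEq ι] (i : ι) (b : ι → Bool) :
    signMonomial (Pi.single i 1) b = boolSign (b i) := by
  rw [signMonomial, Finset.prod_eq_single i]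
  · simp
  · intro j _ hj; simp [hj]
  · simp

theorem boolSign_sq (b : Bool) : boolSign b * boolSign b = 1 := by
  cases b <;> simp [boolSign]

theorem abs_boolSign (b : Bool) : |boolSign b| = 1 := by
  cases b <;> simp [boolSign]

theorem expect_prod_apply {ι : Type*} [Fintype ι] [DecidableEq ι] (g : ι → Bool → ℝ) :
    𝔼 b : ι → Bool, ∏ i, g i (b i) = ∏ i, ((g i true + g i false) / 2) := by
  rw [Fintype.expect_eq_sum_div_card]
  have h := Finset.prod_univ_sum (fun _ : ι => (Finset.univ : Finset Bool)) (fun i c => g i c)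
  rw [Fintype.piFinset_univ] at h
  rw [← h, Finset.prod_div_distrib]
  simp

/-- The mean is 1 if all exponents are even and 0 otherwise. Nonnegativity is what allows
coefficients to be enlarged under the expectation. -/
theorem expect_signMonomial_nonneg {ι : Type*} [Fintype ι] [DecidableEq ι] (e : ι → ℕ) :
    0 ≤ 𝔼 b : ι → Bool, signMonomial e b := by
  have := expect_prod_apply (fun i c => boolSign c ^ e i)
  simp only [signMonomial]
  rw [this]
  refine Finset.prod_nonneg fun i _ => ?_
  rcases Nat.even_or_odd (e i) with h | h <;> simp [boolSign, h.neg_one_pow]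

/-- The exponential moment of the sum is a power of `cosh`, hence sub-Gaussian; even moments follow
from `t^(2m)/(2m)! ≤ e^t`. -/
theorem expect_even_pow_sum_boolSign_le {ι : Type*} [Fintype ι] [DecidableEq ι] {m : ℕ}
    (hm : 0 < m) :
    𝔼 b : ι → Bool, (∑ i, boolSign (b i)) ^ (2 * m) ≤ (11 * m * Fintype.card ι : ℝ) ^ m := by
  rcases (Fintype.card ι).eq_zero_or_pos with h0 | hk
  · have := Fintype.card_eq_zero_iff.mp h0
    simp [hm.ne']
  have hk' : (0 : ℝ) < Fintype.card ι := by exact_mod_cast hk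
  have hm' : (0 : ℝ) < m := by exact_mod_cast hm
  set k : ℝ := (Fintype.card ι : ℝ) with hkdef
  -- This choice makes the exponent `l^2 k / 2` equal to `m` and minimises the resulting bound.
  set l : ℝ := √(2 * m / k) with hl
  have hlpos : 0 < l := Real.sqrt_pos.mpr (by positivity)
  have hl2 : l ^ 2 = 2 * m / k := Real.sq_sqrt (by positivity)
  have hexp : ∀ s : ℝ, 𝔼 b : ι → Bool, Real.exp (s * ∑ i, boolSign (b i)) ≤
      Real.exp (s ^ 2 / 2 * k) := by
    intro s
    have h1 : ∀ b : ι → Bool, Real.exp (s * ∑ i, boolSign (b i)) =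
        ∏ i, Real.exp (s * boolSign (b i)) := by
      intro b; rw [Finset.mul_sum, Real.exp_sum]
    simp_rw [h1]
    rw [expect_prod_apply (fun _ c => Real.exp (s * boolSign c))]
    simp only [boolSign, if_true, Bool.false_eq_true, if_false, mul_one, mul_neg]
    rw [Finset.prod_const, ← Real.cosh_eq, Finset.card_univ]
    calc Real.cosh s ^ Fintype.card ι ≤ Real.exp (s ^ 2 / 2) ^ Fintype.card ι :=
          pow_le_pow_left₀ (Real.cosh_pos s).le (Real.cosh_le_exp_half_sq s) _
      _ = _ := by rw [← Real.exp_nat_mul, mul_comm]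
  have hpt : ∀ S : ℝ, S ^ (2 * m) ≤ ((2 * m).factorial / l ^ (2 * m)) *
      (Real.exp (l * S) + Real.exp (-l * S)) := by
    intro S
    have h1 := Real.pow_div_factorial_le_exp |l * S| (abs_nonneg _) (2 * m)
    have h2 : Real.exp |l * S| ≤ Real.exp (l * S) + Real.exp (-l * S) := by
      rcases abs_cases (l * S) with ⟨h, _⟩ | ⟨h, _⟩ <;> rw [h]
      · linarith [Real.exp_pos (-l * S)]
      · rw [neg_mul]; linarith [Real.exp_pos (l * S)]
    rw [(even_two_mul m).pow_abs, mul_pow] at h1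
    have hf : (0 : ℝ) < (2 * m).factorial := by exact_mod_cast Nat.factorial_pos _
    have h3 := h1.trans h2
    rw [div_le_iff₀ hf] at h3
    rw [div_mul_eq_mul_div, le_div_iff₀ (by positivity)]
    linarith
  calc 𝔼 b : ι → Bool, (∑ i, boolSign (b i)) ^ (2 * m)
      ≤ 𝔼 b : ι → Bool, ((2 * m).factorial / l ^ (2 * m)) *
        (Real.exp (l * ∑ i, boolSign (b i)) + Real.exp (-l * ∑ i, boolSign (b i))) :=
        Finset.expect_le_expect fun b _ => hpt _
    _ ≤ ((2 * m).factorial / l ^ (2 * m)) * (2 * Real.exp m) := by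
        rw [← Finset.mul_expect, Finset.expect_add_distrib]
        refine mul_le_mul_of_nonneg_left ?_ (by positivity)
        have h1 := hexp l
        have h2 := hexp (-l)
        rw [neg_sq] at h2
        have : l ^ 2 / 2 * k = m := by rw [hl2]; field_simp
        rw [this] at h1 h2
        linarith
    _ ≤ (11 * m * k) ^ m := by
        rw [pow_mul, hl2]
        have hfac : ((2 * m).factorial : ℝ) ≤ ((2 * m : ℝ) ^ 2) ^ m := by
          rw [← pow_mul]
          exact_mod_cast Nat.factorial_le_pow (2 * m)
        -- The base 5.5 is `2 · 2.75`, with `e ≤ 2.75`; together with `(2m)^2 / (2m/k) = 2mk` it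
        -- produces the constant 11.
        have he : 2 * Real.exp m ≤ (5.5 : ℝ) ^ m := by
          have h1 : Real.exp m = Real.exp 1 ^ m := by rw [← Real.exp_nat_mul, mul_one]
          have h2 : Real.exp 1 ≤ 2.75 := by linarith [Real.exp_one_lt_d9]
          have h3 : (2 : ℝ) ≤ 2 ^ m := by
            calc (2 : ℝ) = 2 ^ 1 := by norm_num
              _ ≤ _ := pow_le_pow_right₀ (by norm_num) hm
          rw [h1]
          calc 2 * Real.exp 1 ^ m ≤ 2 ^ m * 2.75 ^ m := by gcongr
            _ = _ := by rw [← mul_pow]; norm_num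
        calc ((2 * m).factorial : ℝ) / (2 * m / k) ^ m * (2 * Real.exp m)
            ≤ ((2 * m : ℝ) ^ 2) ^ m / (2 * m / k) ^ m * 5.5 ^ m := by gcongr
          _ = _ := by
            rw [← div_pow, ← mul_pow]; congr 1; field_simp; norm_num

theorem expect_even_pow_le {β : Type*} [Fintype β] [Nonempty β] (f : β → ℝ) {n : ℕ}
    (hn : Even n) : (𝔼 b, f b) ^ n ≤ 𝔼 b, f b ^ n := by
  have hc : (0 : ℝ) < Fintype.card β := by exact_mod_cast Fintype.card_pos
  have h := Real.pow_arith_mean_le_arith_mean_pow_of_even Finset.univ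
    (fun _ : β => (Fintype.card β : ℝ)⁻¹) f (fun _ _ => by positivity)
    (by rw [Finset.sum_const, Finset.card_univ, nsmul_eq_mul]; field_simp) hn
  rw [← Finset.mul_sum, ← Finset.mul_sum] at h
  rw [Fintype.expect_eq_sum_div_card, Fintype.expect_eq_sum_div_card, div_eq_inv_mul,
    div_eq_inv_mul]
  exact h

/-! ### Trace moments of random matrices, dominated by scalar moments. -/

/-- A random matrix `F` is dominated by a random scalar `g` if both expand into sign monomials,
the absolute row sums of the matrix coefficients being bounded by the scalar coefficients. -/
def SignDominated {ι W W' : Type*} [Fintype ι] [Fintype W'] (F : (ι → Bool) → Matrix W W' ℝ)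
    (g : (ι → Bool) → ℝ) : Prop :=
  ∃ (m : ℕ) (e : Fin m → ι → ℕ) (a : Fin m → Matrix W W' ℝ) (r : Fin m → ℝ),
    (∀ j w, ∑ w', |a j w w'| ≤ r j) ∧ (∀ j, 0 ≤ r j) ∧
      ∀ b, (∀ w w', F b w w' = ∑ j, signMonomial (e j) b * a j w w') ∧
        g b = ∑ j, signMonomial (e j) b * r j

theorem SignDominated.of_fintype {ι W W' J : Type*} [Fintype ι] [Fintype W'] [Fintype J]
    {F : (ι → Bool) → Matrix W W' ℝ} {g : (ι → Bool) → ℝ}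
    (e : J → ι → ℕ) (a : J → Matrix W W' ℝ) (r : J → ℝ)
    (ha : ∀ j w, ∑ w', |a j w w'| ≤ r j) (hr : ∀ j, 0 ≤ r j)
    (hF : ∀ b w w', F b w w' = ∑ j, signMonomial (e j) b * a j w w')
    (hg : ∀ b, g b = ∑ j, signMonomial (e j) b * r j) : SignDominated F g := by
  let f := Fintype.equivFin J
  refine ⟨Fintype.card J, fun j => e (f.symm j), fun j => a (f.symm j), fun j => r (f.symm j),
    fun j w => ha _ w, fun j => hr _, fun b => ⟨fun w w' => ?_, ?_⟩⟩
  · rw [hF]; exact (f.symm.sum_comp fun j => signMonomial (e j) b * a j w w').symm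
  · rw [hg]; exact (f.symm.sum_comp fun j => signMonomial (e j) b * r j).symm

/-- Exponent vectors add and the maximal absolute row sum is submultiplicative. -/
theorem SignDominated.mul {ι W W' W'' : Type*} [Fintype ι] [Fintype W'] [Fintype W'']
    {F : (ι → Bool) → Matrix W W' ℝ} {F' : (ι → Bool) → Matrix W' W'' ℝ}
    {g g' : (ι → Bool) → ℝ} (h : SignDominated F g) (h' : SignDominated F' g') :
    SignDominated (fun b => F b * F' b) (fun b => g b * g' b) := by
  obtain ⟨m, e, a, r, ha, hr, hb⟩ := h
  obtain ⟨m', e', a', r', ha', hr', hb'⟩ := h'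
  refine SignDominated.of_fintype (J := Fin m × Fin m') (fun j => e j.1 + e' j.2)
    (fun j => a j.1 * a' j.2) (fun j => r j.1 * r' j.2) ?_
    (fun j => mul_nonneg (hr _) (hr' _)) ?_ ?_
  · intro j w
    calc ∑ w'', |(a j.1 * a' j.2) w w''|
        ≤ ∑ w'', ∑ w', |a j.1 w w'| * |a' j.2 w' w''| := by
          refine Finset.sum_le_sum fun w'' _ => ?_
          rw [Matrix.mul_apply]
          refine (Finset.abs_sum_le_sum_abs _ _).trans (le_of_eq ?_)
          simp [abs_mul]
      _ = ∑ w', |a j.1 w w'| * ∑ w'', |a' j.2 w' w''| := by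
          rw [Finset.sum_comm]; simp [Finset.mul_sum]
      _ ≤ ∑ w', |a j.1 w w'| * r' j.2 :=
          Finset.sum_le_sum fun w' _ => mul_le_mul_of_nonneg_left (ha' _ _) (abs_nonneg _)
      _ ≤ r j.1 * r' j.2 := by
          rw [← Finset.sum_mul]; exact mul_le_mul_of_nonneg_right (ha _ _) (hr' _)
  · intro b w w''
    rw [Matrix.mul_apply, Fintype.sum_prod_type]
    simp_rw [(hb b).1, (hb' b).1, Finset.sum_mul_sum, signMonomial_add, Matrix.mul_apply,
      Finset.mul_sum]
    rw [Finset.sum_comm]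
    refine Finset.sum_congr rfl fun j _ => ?_
    rw [Finset.sum_comm]
    refine Finset.sum_congr rfl fun j' _ => Finset.sum_congr rfl fun w' _ => by ring
  · intro b
    rw [(hb b).2, (hb' b).2, Finset.sum_mul_sum, Fintype.sum_prod_type]
    refine Finset.sum_congr rfl fun j _ => Finset.sum_congr rfl fun j' _ => ?_
    rw [signMonomial_add]; ring

theorem SignDominated.pow {ι W : Type*} [Fintype ι] [Fintype W] [DecidableEq W]
    {F : (ι → Bool) → Matrix W W ℝ} {g : (ι → Bool) → ℝ} (h : SignDominated F g) (m : ℕ) :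
    SignDominated (fun b => F b ^ m) (fun b => g b ^ m) := by
  induction m with
  | zero =>
    refine SignDominated.of_fintype (J := Unit) (fun _ => 0) (fun _ => 1) (fun _ => 1)
      ?_ (fun _ => zero_le_one) ?_ ?_
    · intro _ w
      rw [Finset.sum_eq_single w]
      · simp
      · intro w' _ hw; simp [Matrix.one_apply_ne' hw]
      · simp
    · intro b w w'; simp [signMonomial_zero]
    · intro b; simp [signMonomial_zero]
  | succ m ih =>
    simp_rw [pow_succ]
    exact ih.mul h

/-- Each monomial has nonnegative mean, so the trace of each coefficient may be replaced by its
bound `|W| r j` term by term. This plays the role of a matrix Khintchine inequality. -/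
theorem SignDominated.expect_trace_le {ι W : Type*} [Fintype ι] [DecidableEq ι] [Fintype W]
    {F : (ι → Bool) → Matrix W W ℝ} {g : (ι → Bool) → ℝ} (h : SignDominated F g) :
    𝔼 b, (F b).trace ≤ Fintype.card W * 𝔼 b, g b := by
  obtain ⟨m, e, a, r, ha, hr, hb⟩ := h
  have h1 : ∀ b, (F b).trace = ∑ j, signMonomial (e j) b * (a j).trace := by
    intro b
    simp_rw [Matrix.trace, Matrix.diag, (hb b).1, Finset.mul_sum]
    rw [Finset.sum_comm]
  have h2 : ∀ j, (a j).trace ≤ Fintype.card W * r j := by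
    intro j
    calc (a j).trace ≤ ∑ _w : W, r j := by
          refine Finset.sum_le_sum fun w _ => ?_
          exact (le_abs_self _).trans
            ((Finset.single_le_sum (f := fun w' => |a j w w'|) (fun _ _ => abs_nonneg _)
              (Finset.mem_univ w)).trans (ha j w))
      _ = _ := by simp
  simp_rw [h1, (hb _).2]
  rw [Finset.expect_sum_comm, Finset.expect_sum_comm, Finset.mul_sum]
  refine Finset.sum_le_sum fun j _ => ?_
  rw [← Finset.expect_mul, ← Finset.expect_mul]
  calc _ ≤ (𝔼 b, signMonomial (e j) b) * (Fintype.card W * r j) :=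
        mul_le_mul_of_nonneg_left (h2 j) (expect_signMonomial_nonneg _)
    _ = _ := by ring

theorem signDominated_rademacher {ι W W' : Type*} [Fintype ι] [DecidableEq ι] [Fintype W']
    (M : ι → Matrix W W' ℝ) {D : ℝ} (hD : 0 ≤ D) (h : ∀ i w, ∑ w', |M i w w'| ≤ D) :
    SignDominated (fun b => ∑ i, boolSign (b i) • M i) (fun b => D * ∑ i, boolSign (b i)) := by
  refine SignDominated.of_fintype (J := ι) (fun i => Pi.single i 1) M (fun _ => D) h
    (fun _ => hD) ?_ ?_
  · intro b w w'
    simp [signMonomial_single, Matrix.sum_apply]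
  · intro b
    simp_rw [signMonomial_single]
    rw [← Finset.sum_mul, mul_comm]

/-! ### Bilinear forms of Rademacher sums of matrices. -/

open Matrix in
theorem dotProduct_gram_mulVec {W W' : Type*} [Fintype W] [Fintype W'] (R : Matrix W W' ℝ)
    (y : W' → ℝ) : y ⬝ᵥ ((Rᵀ * R) *ᵥ y) = (R *ᵥ y) ⬝ᵥ (R *ᵥ y) := by
  rw [← Matrix.mulVec_mulVec, Matrix.dotProduct_mulVec, Matrix.vecMul_transpose]

theorem sq_dotProduct_le {W : Type*} [Fintype W] (x y : W → ℝ) :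
    (x ⬝ᵥ y) ^ 2 ≤ (x ⬝ᵥ x) * (y ⬝ᵥ y) := by
  have := Finset.sum_mul_sq_le_sq_mul_sq Finset.univ x y
  simpa [dotProduct, sq] using this

theorem dotProduct_self_nonneg_real {W : Type*} [Fintype W] (x : W → ℝ) : 0 ≤ x ⬝ᵥ x :=
  Finset.sum_nonneg fun _ _ => mul_self_nonneg _

open Matrix in
-- Cauchy–Schwarz squares the Gram matrix at each step of the induction, and one use of it per row
-- gives the base case. The induction replaces `R` by the square matrix `RᵀR`, so `W` and `W'` share
-- a universe.
theorem quadratic_pow_two_pow_le_trace {W W' : Type u} [Fintype W] [Fintype W'] [DecidableEq W']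
    (r : ℕ) (R : Matrix W W' ℝ) (y : W' → ℝ) :
    (y ⬝ᵥ ((Rᵀ * R) *ᵥ y)) ^ 2 ^ r ≤ (y ⬝ᵥ y) ^ 2 ^ r * ((Rᵀ * R) ^ 2 ^ r).trace := by
  induction r generalizing W R with
  | zero =>
    simp only [pow_zero, pow_one]
    rw [dotProduct_gram_mulVec]
    calc (R *ᵥ y) ⬝ᵥ (R *ᵥ y) = ∑ w, (R w ⬝ᵥ y) ^ 2 := by
          simp only [dotProduct, mulVec, sq]
      _ ≤ ∑ w, (R w ⬝ᵥ R w) * (y ⬝ᵥ y) := Finset.sum_le_sum fun w _ => sq_dotProduct_le _ _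
      _ = _ := by
        rw [← Finset.sum_mul, mul_comm, Matrix.trace]
        congr 1
        simp only [dotProduct, Matrix.diag, Matrix.mul_apply, Matrix.transpose_apply]
        rw [Finset.sum_comm]
  | succ r ih =>
    set S := Rᵀ * R with hS
    have hSt : Sᵀ = S := by rw [hS, Matrix.transpose_mul, Matrix.transpose_transpose]
    have h1 : (y ⬝ᵥ (S *ᵥ y)) ^ 2 ≤ (y ⬝ᵥ y) * (y ⬝ᵥ ((Sᵀ * S) *ᵥ y)) := by
      rw [dotProduct_gram_mulVec S]; exact sq_dotProduct_le _ _
    have h2 := ih S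
    rw [hSt, ← sq] at h2
    rw [hSt, ← sq] at h1
    calc (y ⬝ᵥ (S *ᵥ y)) ^ 2 ^ (r + 1) = ((y ⬝ᵥ (S *ᵥ y)) ^ 2) ^ 2 ^ r := by
          rw [← pow_mul, pow_succ']
      _ ≤ ((y ⬝ᵥ y) * (y ⬝ᵥ (S ^ 2 *ᵥ y))) ^ 2 ^ r := pow_le_pow_left₀ (sq_nonneg _) h1 _
      _ = (y ⬝ᵥ y) ^ 2 ^ r * (y ⬝ᵥ (S ^ 2 *ᵥ y)) ^ 2 ^ r := mul_pow _ _ _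
      _ ≤ (y ⬝ᵥ y) ^ 2 ^ r * ((y ⬝ᵥ y) ^ 2 ^ r * ((S ^ 2) ^ 2 ^ r).trace) :=
          mul_le_mul_of_nonneg_left h2 (pow_nonneg (dotProduct_self_nonneg_real y) _)
      _ = _ := by
        rw [← mul_assoc, ← mul_pow, ← sq, ← pow_mul, ← pow_mul, ← pow_succ']

theorem exists_two_pow_between {L : ℝ} (hL : 1 ≤ L) :
    ∃ r : ℕ, L ≤ (2 : ℝ) ^ r ∧ (2 : ℝ) ^ r ≤ 2 * L := by
  obtain ⟨n, h1, h2⟩ := exists_nat_pow_near hL (by norm_num : (1 : ℝ) < 2)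
  exact ⟨n + 1, h2.le, by rw [pow_succ]; linarith⟩

theorem dotProduct_self_le_card {W : Type*} [Fintype W] {x : W → ℝ} (hx : ∀ w, |x w| ≤ 1) :
    x ⬝ᵥ x ≤ Fintype.card W := by
  calc x ⬝ᵥ x ≤ ∑ _w : W, (1 : ℝ) := Finset.sum_le_sum fun w _ => by
        rw [← sq, ← sq_abs]; exact pow_le_one₀ (abs_nonneg _) (hx w)
    _ = _ := by simp

open Matrix in
/-- A Rademacher sum of matrices with small absolute row and column sums is small on average, as a
bilinear form on the cube. -/
theorem expect_rademacher_bilinear_le {ι : Type*} {W W' : Type u} [Fintype ι] [DecidableEq ι]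
    [Fintype W] [Fintype W'] (M : ι → Matrix W W' ℝ) {D L : ℝ} (hD : 0 ≤ D)
    (hrow : ∀ i w, ∑ w', |M i w w'| ≤ D) (hcol : ∀ i w', ∑ w, |M i w w'| ≤ D)
    (hL : 1 ≤ L) (hW : (Fintype.card W' : ℝ) ≤ Real.exp L)
    (x : (ι → Bool) → W → ℝ) (y : (ι → Bool) → W' → ℝ)
    (hx : ∀ b w, |x b w| ≤ 1) (hy : ∀ b w, |y b w| ≤ 1) :
    𝔼 b, ∑ w, ∑ w', (∑ i, boolSign (b i) * M i w w') * x b w * y b w' ≤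
      D * √(64 * L * Fintype.card ι * Fintype.card W * Fintype.card W') := by
  classical
  -- The moment order `m` must be a power of two for the trace inequality, and at least `L` so that
  -- the dimension factor is at most `e^m`.
  obtain ⟨r, hr1, hr2⟩ := exists_two_pow_between hL
  set m : ℕ := 2 ^ r with hm
  have hmpos : 0 < m := by positivity
  have hmr : (m : ℝ) = 2 ^ r := by rw [hm]; push_cast; rfl
  let B : (ι → Bool) → Matrix W W' ℝ := fun b => ∑ i, boolSign (b i) • M i
  have hB : SignDominated B (fun b => D * ∑ i, boolSign (b i)) := signDominated_rademacher M hD hrow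
  have hBt : SignDominated (fun b => (B b)ᵀ) (fun b => D * ∑ i, boolSign (b i)) := by
    have := signDominated_rademacher (fun i => (M i)ᵀ) hD (fun i w => hcol i w)
    simpa [B, Matrix.transpose_sum] using this
  have htr := ((hBt.mul hB).pow m).expect_trace_le
  set k : ℝ := (Fintype.card ι : ℝ)
  set c : ℝ := (Fintype.card W : ℝ)
  set c' : ℝ := (Fintype.card W' : ℝ)
  have hc : 0 ≤ c := Nat.cast_nonneg _
  have hc' : 0 ≤ c' := Nat.cast_nonneg _
  have hk : 0 ≤ k := Nat.cast_nonneg _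
  have hform : ∀ b, ∑ w, ∑ w', (∑ i, boolSign (b i) * M i w w') * x b w * y b w' =
      x b ⬝ᵥ (B b *ᵥ y b) := by
    intro b
    simp only [dotProduct, mulVec, B, Matrix.sum_apply, Matrix.smul_apply, smul_eq_mul]
    refine Finset.sum_congr rfl fun w _ => ?_
    rw [Finset.mul_sum]
    exact Finset.sum_congr rfl fun w' _ => by ring
  simp_rw [hform]
  set E := 𝔼 b, x b ⬝ᵥ (B b *ᵥ y b)
  have hpt : ∀ b, (x b ⬝ᵥ (B b *ᵥ y b)) ^ (2 * m) ≤
      (c * c') ^ m * (((B b)ᵀ * B b) ^ m).trace := by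
    intro b
    have h2 := quadratic_pow_two_pow_le_trace r (B b) (y b)
    have h0 : 0 ≤ y b ⬝ᵥ (((B b)ᵀ * B b) *ᵥ y b) := by
      rw [dotProduct_gram_mulVec]; exact dotProduct_self_nonneg_real _
    have htr0 : (y b ⬝ᵥ (((B b)ᵀ * B b) *ᵥ y b)) ^ m ≤ c' ^ m * (((B b)ᵀ * B b) ^ m).trace := by
      rcases (dotProduct_self_nonneg_real (y b)).eq_or_lt with h | h
      · have hz : y b = 0 := dotProduct_self_eq_zero.mp h.symm
        have ht : 0 ≤ (((B b)ᵀ * B b) ^ m).trace := by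
          refine (((Matrix.posSemidef_conjTranspose_mul_self (B b)).pow m).trace_nonneg).trans ?_
          simp [Matrix.conjTranspose_eq_transpose_of_trivial]
        rw [hz]
        simp only [Matrix.mulVec_zero, dotProduct_zero, zero_pow hmpos.ne']
        positivity
      · have ht : 0 ≤ (((B b)ᵀ * B b) ^ m).trace := by
          by_contra hneg
          push Not at hneg
          have := mul_neg_of_pos_of_neg (pow_pos h m) hneg
          linarith [pow_nonneg h0 m]
        exact h2.trans (mul_le_mul_of_nonneg_right
          (pow_le_pow_left₀ h.le (dotProduct_self_le_card (hy b)) _) ht)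
    calc (x b ⬝ᵥ (B b *ᵥ y b)) ^ (2 * m) = ((x b ⬝ᵥ (B b *ᵥ y b)) ^ 2) ^ m := pow_mul _ _ _
      _ ≤ (c * (y b ⬝ᵥ (((B b)ᵀ * B b) *ᵥ y b))) ^ m := by
          refine pow_le_pow_left₀ (sq_nonneg _) ?_ _
          rw [dotProduct_gram_mulVec]
          exact (sq_dotProduct_le _ _).trans (mul_le_mul_of_nonneg_right
            (dotProduct_self_le_card (hx b)) (dotProduct_self_nonneg_real _))
      _ ≤ _ := by
          rw [mul_pow, mul_pow, mul_assoc]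
          exact mul_le_mul_of_nonneg_left htr0 (by positivity)
  have hE : E ^ (2 * m) ≤ (D ^ 2 * (64 * L * k * c * c')) ^ m := by
    calc E ^ (2 * m) ≤ 𝔼 b, (x b ⬝ᵥ (B b *ᵥ y b)) ^ (2 * m) :=
          expect_even_pow_le _ (even_two_mul m)
      _ ≤ 𝔼 b, (c * c') ^ m * (((B b)ᵀ * B b) ^ m).trace :=
          Finset.expect_le_expect fun b _ => hpt b
      _ = (c * c') ^ m * 𝔼 b, (((B b)ᵀ * B b) ^ m).trace := by rw [Finset.mul_expect]
      _ ≤ (c * c') ^ m * (c' * 𝔼 b : ι → Bool, (D ^ 2) ^ m * (∑ i, boolSign (b i)) ^ (2 * m)) := by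
          refine mul_le_mul_of_nonneg_left (htr.trans (le_of_eq ?_)) (by positivity)
          congr 1
          refine Finset.expect_congr rfl fun b _ => ?_
          rw [pow_mul, ← mul_pow]; congr 1; ring
      _ ≤ (c * c') ^ m * (Real.exp 1 ^ m * ((D ^ 2) ^ m * (11 * m * k) ^ m)) := by
          rw [← Finset.mul_expect]
          have h1 : c' ≤ Real.exp 1 ^ m := by
            rw [← Real.exp_nat_mul, mul_one]
            exact hW.trans (Real.exp_le_exp.mpr (by rw [hmr]; exact hr1))
          have h2 := expect_even_pow_sum_boolSign_le (ι := ι) hmpos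
          have h3 : 0 ≤ 𝔼 b : ι → Bool, (∑ i, boolSign (b i)) ^ (2 * m) :=
            Finset.expect_nonneg fun b _ => (even_two_mul m).pow_nonneg _
          gcongr
      _ = (D ^ 2 * (Real.exp 1 * 11 * m * k * c * c')) ^ m := by
          rw [← mul_pow, ← mul_pow, ← mul_pow]; congr 1; ring
      _ ≤ _ := by
          -- Since `m ≤ 2L`, the left side is at most `22 e L < 60 L`.
          have h1 : Real.exp 1 * 11 * m ≤ 64 * L := by
            have := Real.exp_one_lt_d9
            rw [hmr]
            have : (0 : ℝ) < 2 ^ r := by positivity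
            nlinarith
          gcongr
  rw [← Real.sqrt_sq hD, ← Real.sqrt_mul (sq_nonneg D)]
  refine Real.le_sqrt_of_sq_le ?_
  rw [pow_mul] at hE
  exact (pow_le_pow_iff_left₀ (sq_nonneg _) (by positivity) hmpos.ne').mp hE

/-- The bilinear bound for Rademacher sums of matrices, after discarding the rows and columns of
large degree. -/
theorem expect_rademacher_bilinear_le_of_degrees {ι : Type*} {W W' : Type u} [Fintype ι]
    [DecidableEq ι] [Fintype W] [Fintype W'] (K : ι → Matrix W W' ℝ) {D L : ℝ} (hD : 0 ≤ D)
    (r : ι → W → ℝ) (c : ι → W' → ℝ)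
    (hrow : ∀ i w, ∑ w', |K i w w'| ≤ r i w) (hcol : ∀ i w', ∑ w, |K i w w'| ≤ c i w')
    (hL : 1 ≤ L) (hW : (Fintype.card W' : ℝ) ≤ Real.exp L)
    (x : (ι → Bool) → W → ℝ) (y : (ι → Bool) → W' → ℝ)
    (hx : ∀ b w, |x b w| ≤ 1) (hy : ∀ b w, |y b w| ≤ 1) :
    𝔼 b, ∑ w, ∑ w', (∑ i, boolSign (b i) * K i w w') * x b w * y b w' ≤
      D * √(64 * L * Fintype.card ι * Fintype.card W * Fintype.card W') +
        ∑ i, (∑ w, (if D < r i w then r i w else 0) + ∑ w', if D < c i w' then c i w' else 0) := by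
  classical
  let M : ι → Matrix W W' ℝ := fun i w w' => if D < r i w ∨ D < c i w' then 0 else K i w w'
  have hMK : ∀ i w w', |M i w w'| ≤ |K i w w'| := by
    intro i w w'; simp only [M]; split_ifs <;> simp
  have hM1 : ∀ i w, ∑ w', |M i w w'| ≤ D := by
    intro i w
    by_cases h : D < r i w
    · simp [M, h, hD]
    · exact (Finset.sum_le_sum fun w' _ => hMK i w w').trans ((hrow i w).trans (not_lt.mp h))
  have hM2 : ∀ i w', ∑ w, |M i w w'| ≤ D := by
    intro i w'
    by_cases h : D < c i w'
    · simp [M, h, hD]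
    · exact (Finset.sum_le_sum fun w _ => hMK i w w').trans ((hcol i w').trans (not_lt.mp h))
  have hmain := expect_rademacher_bilinear_le M hD hM1 hM2 hL hW x y hx hy
  have hdiff : ∀ i w w', |K i w w' - M i w w'| ≤
      (if D < r i w then |K i w w'| else 0) + if D < c i w' then |K i w w'| else 0 := by
    intro i w w'
    have := abs_nonneg (K i w w')
    simp only [M]
    split_ifs <;> simp_all
  have hpt : ∀ b, ∑ w, ∑ w', (∑ i, boolSign (b i) * K i w w') * x b w * y b w' ≤
      ∑ w, ∑ w', (∑ i, boolSign (b i) * M i w w') * x b w * y b w' +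
      ∑ i, (∑ w, (if D < r i w then r i w else 0) +
        ∑ w', if D < c i w' then c i w' else 0) := by
    intro b
    have h1 : ∀ w w', (∑ i, boolSign (b i) * K i w w') * x b w * y b w' ≤
        (∑ i, boolSign (b i) * M i w w') * x b w * y b w' + ∑ i, |K i w w' - M i w w'| := by
      intro w w'
      rw [← sub_le_iff_le_add', ← sub_mul, ← sub_mul, ← Finset.sum_sub_distrib]
      refine (le_abs_self _).trans ?_
      rw [abs_mul, abs_mul]
      calc |∑ i, (boolSign (b i) * K i w w' - boolSign (b i) * M i w w')| * |x b w| * |y b w'|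
          ≤ |∑ i, (boolSign (b i) * K i w w' - boolSign (b i) * M i w w')| * 1 * 1 := by
            gcongr
            exacts [hx _ _, hy _ _]
        _ ≤ _ := by
            rw [mul_one, mul_one]
            refine (Finset.abs_sum_le_sum_abs _ _).trans (le_of_eq ?_)
            simp_rw [← mul_sub, abs_mul, abs_boolSign, one_mul]
    calc _ ≤ ∑ w, ∑ w', ((∑ i, boolSign (b i) * M i w w') * x b w * y b w' +
            ∑ i, |K i w w' - M i w w'|) :=
          Finset.sum_le_sum fun w _ => Finset.sum_le_sum fun w' _ => h1 w w'
      _ = ∑ w, ∑ w', (∑ i, boolSign (b i) * M i w w') * x b w * y b w' +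
            ∑ i, ∑ w, ∑ w', |K i w w' - M i w w'| := by
          simp_rw [Finset.sum_add_distrib]
          congr 1
          conv_rhs => rw [Finset.sum_comm]
          refine Finset.sum_congr rfl fun w _ => ?_
          rw [Finset.sum_comm]
      _ ≤ _ := by
          gcongr with i
          calc ∑ w, ∑ w', |K i w w' - M i w w'|
              ≤ ∑ w, ∑ w', ((if D < r i w then |K i w w'| else 0) +
                if D < c i w' then |K i w w'| else 0) :=
                Finset.sum_le_sum fun w _ => Finset.sum_le_sum fun w' _ => hdiff i w w'
            _ = ∑ w, ∑ w', (if D < r i w then |K i w w'| else 0) +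
                ∑ w', ∑ w, if D < c i w' then |K i w w'| else 0 := by
                simp_rw [Finset.sum_add_distrib]
                congr 1
                rw [Finset.sum_comm]
            _ ≤ _ := by
                gcongr with w _ w' _
                · split_ifs
                  · exact hrow i w
                  · simp
                · split_ifs
                  · exact hcol i w'
                  · simp
  refine (Finset.expect_le_expect fun b _ => hpt b).trans ?_
  rw [Finset.expect_add_distrib, Fintype.expect_const]
  gcongr

/-! ### Concentration of degrees over random tuples. -/

theorem sum_fun_prod_apply {V : Type*} [Fintype V] {l : ℕ} (g : V → ℝ) :
    ∑ A : Fin l → V, ∏ s, g (A s) = (∑ v, g v) ^ l := by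
  rw [Finset.sum_pow', Fintype.piFinset_univ]

/-- Chernoff bound for `l` independent uniform samples of `Y` with values in `[0,τ]`. The
exponential moment at parameter `1/τ` is controlled by `e^t ≤ 1 + 2t` on `[0,1]`, which explains the
threshold: twice the mean bound plus `lam * τ`. -/
theorem card_lt_sum_apply_le {V : Type*} [Fintype V] [Nonempty V] (l : ℕ) (Y : V → ℝ)
    {τ S lam : ℝ} (hτ : 0 < τ) (hY0 : ∀ v, 0 ≤ Y v) (hYτ : ∀ v, Y v ≤ τ) (hS : ∑ v, Y v ≤ S) :
    ((#{A : Fin l → V | 2 * S * l / Fintype.card V + lam * τ < ∑ s, Y (A s)} : ℕ) : ℝ) ≤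
      (Fintype.card V : ℝ) ^ l * Real.exp (-lam) := by
  set N : ℝ := (Fintype.card V : ℝ) with hN
  have hNpos : 0 < N := by rw [hN]; exact_mod_cast Fintype.card_pos
  have hexp : ∀ v, Real.exp (Y v / τ) ≤ 1 + 2 * (Y v / τ) := by
    intro v
    have h0 : 0 ≤ Y v / τ := div_nonneg (hY0 v) hτ.le
    have h1 : Y v / τ ≤ 1 := (div_le_one hτ).mpr (hYτ v)
    have := Real.abs_exp_sub_one_sub_id_le (x := Y v / τ) (by rw [abs_of_nonneg h0]; exact h1)
    have := (abs_le.mp this).2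
    nlinarith
  have hsum : ∑ v, Real.exp (Y v / τ) ≤ N * Real.exp (2 * S / (N * τ)) := by
    calc ∑ v, Real.exp (Y v / τ) ≤ ∑ v, (1 + 2 * (Y v / τ)) :=
          Finset.sum_le_sum fun v _ => hexp v
      _ = N + 2 * ((∑ v, Y v) / τ) := by
          rw [Finset.sum_add_distrib, ← Finset.mul_sum, Finset.sum_div]; simp [hN]
      _ ≤ N + 2 * (S / τ) := by gcongr
      _ = N * (2 * S / (N * τ) + 1) := by field_simp; ring
      _ ≤ _ := by gcongr; exact Real.add_one_le_exp _
  have hall : ∑ A : Fin l → V, Real.exp ((∑ s, Y (A s)) / τ) ≤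
      N ^ l * Real.exp (2 * S * l / N / τ) := by
    calc ∑ A : Fin l → V, Real.exp ((∑ s, Y (A s)) / τ)
        = (∑ v, Real.exp (Y v / τ)) ^ l := by
          rw [← sum_fun_prod_apply]
          refine Finset.sum_congr rfl fun A _ => ?_
          rw [Finset.sum_div, Real.exp_sum]
      _ ≤ (N * Real.exp (2 * S / (N * τ))) ^ l :=
          pow_le_pow_left₀ (Finset.sum_nonneg fun v _ => (Real.exp_pos _).le) hsum _
      _ = _ := by
          rw [mul_pow, ← Real.exp_nat_mul]; congr 2; field_simp
  set B : ℝ := 2 * S * l / N + lam * τ with hB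
  have hB' : B / τ = 2 * S * l / N / τ + lam := by rw [hB]; field_simp
  have hmark : (#{A : Fin l → V | B < ∑ s, Y (A s)} : ℝ) * Real.exp (B / τ) ≤
      ∑ A : Fin l → V, Real.exp ((∑ s, Y (A s)) / τ) := by
    rw [← nsmul_eq_mul]
    refine (Finset.card_nsmul_le_sum _ (fun A : Fin l → V => Real.exp ((∑ s, Y (A s)) / τ)) _
      ?_).trans (Finset.sum_le_sum_of_subset_of_nonneg (Finset.filter_subset _ _)
        fun _ _ _ => (Real.exp_pos _).le)
    intro A hA
    have := (Finset.mem_filter.mp hA).2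
    gcongr
  have h := hmark.trans hall
  rw [hB', Real.exp_add, ← mul_assoc] at h
  rw [Real.exp_neg, ← div_eq_mul_inv, le_div_iff₀ (Real.exp_pos _)]
  have he := Real.exp_pos (2 * S * l / N / τ)
  nlinarith

/-- The total degree of the pairs of tuples whose degree is atypically large. -/
theorem sum_large_degree_le {V : Type*} [Fintype V] [Nonempty V] (l : ℕ) (Q : V → V → ℝ)
    {τ κ lam D₁ D : ℝ} (hτ : 0 < τ) (hlam : 0 < lam) (hκ : 0 ≤ κ) (hQ0 : ∀ v w, 0 ≤ Q v w)
    (hQτ : ∀ v w, Q v w ≤ τ) (hQr : ∀ v, ∑ w, Q v w ≤ κ) (hQc : ∀ w, ∑ v, Q v w ≤ κ)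
    (hD₁ : D₁ = 2 * κ * l / Fintype.card V + lam * τ)
    (hD : D = 2 * (κ * l) * l / Fintype.card V + lam * D₁) :
    ∑ p : (Fin l → V) × (Fin l → V), (if D < ∑ s, ∑ t, Q (p.1 s) (p.2 t) then
        ∑ s, ∑ t, Q (p.1 s) (p.2 t) else 0) ≤
      2 * Fintype.card V * ((Fintype.card V : ℝ) ^ l) ^ 2 * Real.exp (-lam) * (l ^ 2 * κ) := by
  classical
  set N : ℝ := (Fintype.card V : ℝ) with hN
  have hNpos : 1 ≤ N := by rw [hN]; exact_mod_cast Fintype.card_pos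
  have hD₁pos : 0 < D₁ := by rw [hD₁]; positivity
  have hdeg : ∀ p : (Fin l → V) × (Fin l → V), ∑ s, ∑ t, Q (p.1 s) (p.2 t) ≤ l ^ 2 * κ := by
    intro p
    calc ∑ s, ∑ t, Q (p.1 s) (p.2 t) ≤ ∑ _s : Fin l, ∑ _t : Fin l, κ :=
          Finset.sum_le_sum fun s _ => Finset.sum_le_sum fun t _ =>
            (Finset.single_le_sum (f := fun w => Q (p.1 s) w) (fun w _ => hQ0 _ w)
              (Finset.mem_univ _)).trans (hQr _)
      _ = _ := by simp; ring
  set e := Real.exp (-lam)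
  have he : 0 < e := Real.exp_pos _
  -- The degree is bilinear in the two tuples, so Chernoff is applied twice. A union bound over `v`
  -- excludes the `B` with a partial degree above `D₁`; for the other `B`, the cap `D₁` takes the
  -- place of `τ` in the bound over `A`.
  have hbadB : ((#{B : Fin l → V | ∃ v, D₁ < ∑ t, Q v (B t)} : ℕ) : ℝ) ≤ N * (N ^ l * e) := by
    have hsub : ({B : Fin l → V | ∃ v, D₁ < ∑ t, Q v (B t)} : Finset _) ⊆
        Finset.univ.biUnion fun v => {B : Fin l → V | D₁ < ∑ t, Q v (B t)} := by
      intro B; simp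
    calc ((#{B : Fin l → V | ∃ v, D₁ < ∑ t, Q v (B t)} : ℕ) : ℝ)
        ≤ ∑ v, (#{B : Fin l → V | D₁ < ∑ t, Q v (B t)} : ℝ) := by
          exact_mod_cast (Finset.card_le_card hsub).trans Finset.card_biUnion_le
      _ ≤ ∑ _v : V, N ^ l * e := by
          refine Finset.sum_le_sum fun v _ => ?_
          rw [hD₁]
          exact card_lt_sum_apply_le l (Q v) hτ (hQ0 v) (hQτ v) (hQr v)
      _ = _ := by simp [hN]
  have hbadA : ∀ B : Fin l → V, ¬ (∃ v, D₁ < ∑ t, Q v (B t)) →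
      ((#{A : Fin l → V | D < ∑ s, ∑ t, Q (A s) (B t)} : ℕ) : ℝ) ≤ N ^ l * e := by
    intro B hB
    push Not at hB
    rw [hD]
    refine card_lt_sum_apply_le l (fun v => ∑ t, Q v (B t)) hD₁pos
      (fun v => Finset.sum_nonneg fun t _ => hQ0 _ _) hB ?_
    rw [Finset.sum_comm]
    calc ∑ t, ∑ v, Q v (B t) ≤ ∑ _t : Fin l, κ := Finset.sum_le_sum fun t _ => hQc _
      _ = _ := by simp; ring
  have hcount : ∑ p : (Fin l → V) × (Fin l → V),
      (if D < ∑ s, ∑ t, Q (p.1 s) (p.2 t) then (1 : ℝ) else 0) ≤ 2 * N * (N ^ l) ^ 2 * e := by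
    rw [Fintype.sum_prod_type_right]
    have h1 : ∀ B : Fin l → V, ∑ A : Fin l → V,
        (if D < ∑ s, ∑ t, Q (A s) (B t) then (1 : ℝ) else 0) ≤
        (if ∃ v, D₁ < ∑ t, Q v (B t) then N ^ l else 0) + N ^ l * e := by
      intro B
      by_cases hB : ∃ v, D₁ < ∑ t, Q v (B t)
      · rw [if_pos hB]
        calc _ ≤ ∑ _A : Fin l → V, (1 : ℝ) :=
              Finset.sum_le_sum fun A _ => by split_ifs <;> norm_num
          _ = N ^ l := by simp [hN]
          _ ≤ _ := by have : 0 ≤ N ^ l * e := by positivity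
                      linarith
      · rw [if_neg hB, zero_add]
        refine le_trans (le_of_eq ?_) (hbadA B hB)
        simp
    refine (Finset.sum_le_sum fun B _ => h1 B).trans ?_
    rw [Finset.sum_add_distrib, ← Finset.sum_filter, Finset.sum_const, Finset.sum_const,
      nsmul_eq_mul, nsmul_eq_mul, Finset.card_univ, Fintype.card_fun, Fintype.card_fin]
    push_cast
    rw [← hN]
    have h2 : 0 ≤ N ^ l * (N ^ l * e) := by positivity
    have h3 : N ^ l * (N ^ l * e) ≤ N * (N ^ l * (N ^ l * e)) := le_mul_of_one_le_left h2 hNpos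
    have h4 := mul_le_mul_of_nonneg_right hbadB (show 0 ≤ N ^ l by positivity)
    nlinarith
  calc _ ≤ ∑ p : (Fin l → V) × (Fin l → V),
        (if D < ∑ s, ∑ t, Q (p.1 s) (p.2 t) then (1 : ℝ) else 0) * (l ^ 2 * κ) := by
        refine Finset.sum_le_sum fun p _ => ?_
        split_ifs
        · rw [one_mul]; exact hdeg p
        · simp
    _ ≤ _ := by
        rw [← Finset.sum_mul]
        exact mul_le_mul_of_nonneg_right hcount (by positivity)

/-! ### Kikuchi matrices of 4-tensors. -/

/-- Two tuples agree at all positions except possibly `s`. -/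
def AgreeOff {V : Type*} {l : ℕ} (s : Fin l) (A A' : Fin l → V) : Prop :=
  ∀ t, t ≠ s → A t = A' t

theorem AgreeOff.symm {V : Type*} {l : ℕ} {s : Fin l} {A A' : Fin l → V} (h : AgreeOff s A A') :
    AgreeOff s A' A := fun t ht => (h t ht).symm

theorem agreeOff_comm {V : Type*} {l : ℕ} {s : Fin l} {A A' : Fin l → V} :
    AgreeOff s A A' ↔ AgreeOff s A' A := ⟨AgreeOff.symm, AgreeOff.symm⟩

open Classical in
theorem sum_agreeOff {V : Type*} [Fintype V] {l : ℕ} (s : Fin l) (A : Fin l → V) (g : V → ℝ) :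
    ∑ A' : Fin l → V, (if AgreeOff s A A' then g (A' s) else 0) = ∑ v, g v := by
  rw [← Finset.sum_filter]
  refine Finset.sum_bij' (fun A' _ => A' s) (fun v _ => Function.update A s v) ?_ ?_ ?_ ?_ ?_
  · simp
  · intro v _
    simp only [Finset.mem_filter, Finset.mem_univ, true_and]
    intro t ht; simp [ht]
  · intro A' hA'
    ext t
    have := (Finset.mem_filter.mp hA').2 t
    by_cases ht : t = s
    · subst ht; simp
    · simp [ht, this ht]
  · simp
  · simp

/-- Double counting of the pairs of tuples that agree off `s`. The factor `|V|` on the left avoids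
the exponent `l - 1`. -/
theorem card_mul_sum_apply {V : Type*} [Fintype V] {l : ℕ} (s : Fin l) (g : V → ℝ) :
    (Fintype.card V : ℝ) * ∑ A : Fin l → V, g (A s) = (Fintype.card V : ℝ) ^ l * ∑ v, g v := by
  classical
  have h1 : ∑ A : Fin l → V, ∑ A' : Fin l → V, (if AgreeOff s A A' then g (A' s) else 0) =
      (Fintype.card V : ℝ) ^ l * ∑ v, g v := by
    simp_rw [sum_agreeOff]
    simp
  rw [← h1, Finset.sum_comm, Finset.mul_sum]
  refine Finset.sum_congr rfl fun A' _ => ?_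
  have h2 := sum_agreeOff s A' (fun _ : V => g (A' s))
  simp_rw [agreeOff_comm (A := A')] at h2
  rw [h2]; simp

/-- All positions but `s` cancel because the values square to one; hence product vectors on tuples
recover the tensor from its Kikuchi matrix. -/
theorem prod_mul_prod_of_agreeOff {V : Type*} {l : ℕ} {s : Fin l} {A A' : Fin l → V}
    (h : AgreeOff s A A') {y : V → ℝ} (hy : ∀ v, y v * y v = 1) :
    (∏ t, y (A t)) * ∏ t, y (A' t) = y (A s) * y (A' s) := by
  rw [← Finset.prod_mul_distrib, Finset.prod_eq_single s]
  · intro t _ ht; rw [h t ht, hy]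
  · simp

open Classical in
/-- The Kikuchi matrix of a `4`-tensor, on pairs of `l`-tuples. -/
noncomputable def kikuchiMatrix {V : Type*} (l : ℕ) (F : V → V → V → V → ℝ) :
    Matrix ((Fin l → V) × (Fin l → V)) ((Fin l → V) × (Fin l → V)) ℝ :=
  -- The indices are crossed: the row supplies `v` and `w'`, the column `v'` and `w`. A row degree
  -- thus pairs one index from each of the two 3-tensors that are multiplied later, and lightness
  -- can bound it.
  fun p q => ∑ s, ∑ t, if AgreeOff s p.1 q.1 then
    (if AgreeOff t p.2 q.2 then F (p.1 s) (q.2 t) (q.1 s) (p.2 t) else 0) else 0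

open Classical in
theorem sum_agreeOff_agreeOff {V : Type*} [Fintype V] {l : ℕ} (s t : Fin l) (A B : Fin l → V)
    (g : V → V → ℝ) :
    ∑ q : (Fin l → V) × (Fin l → V), (if AgreeOff s A q.1 then
      (if AgreeOff t B q.2 then g (q.1 s) (q.2 t) else 0) else 0) = ∑ v, ∑ w, g v w := by
  rw [Fintype.sum_prod_type, ← sum_agreeOff s A]
  refine Finset.sum_congr rfl fun A' _ => ?_
  split_ifs
  · exact sum_agreeOff t B (g (A' s))
  · simp

theorem sum_abs_kikuchiMatrix_row_le {V : Type*} [Fintype V] (l : ℕ) (F : V → V → V → V → ℝ)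
    (p : (Fin l → V) × (Fin l → V)) :
    ∑ q, |kikuchiMatrix l F p q| ≤
      ∑ s, ∑ t, ∑ v', ∑ w, |F (p.1 s) w v' (p.2 t)| := by
  classical
  calc ∑ q, |kikuchiMatrix l F p q|
      ≤ ∑ q : (Fin l → V) × (Fin l → V), ∑ s, ∑ t, (if AgreeOff s p.1 q.1 then
        (if AgreeOff t p.2 q.2 then |F (p.1 s) (q.2 t) (q.1 s) (p.2 t)| else 0) else 0) := by
        refine Finset.sum_le_sum fun q _ => ?_
        refine (Finset.abs_sum_le_sum_abs _ _).trans (Finset.sum_le_sum fun s _ => ?_)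
        refine (Finset.abs_sum_le_sum_abs _ _).trans (Finset.sum_le_sum fun t _ => ?_)
        split_ifs <;> simp
    _ = _ := by
        rw [Finset.sum_comm]
        refine Finset.sum_congr rfl fun s _ => ?_
        rw [Finset.sum_comm]
        refine Finset.sum_congr rfl fun t _ => ?_
        exact sum_agreeOff_agreeOff s t p.1 p.2 fun v' w => |F (p.1 s) w v' (p.2 t)|

/-- Transposing the Kikuchi matrix amounts to exchanging `(v,w)` with `(v',w')` in the tensor. -/
theorem sum_abs_kikuchiMatrix_col_le {V : Type*} [Fintype V] (l : ℕ) (F : V → V → V → V → ℝ)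
    (q : (Fin l → V) × (Fin l → V)) :
    ∑ p, |kikuchiMatrix l F p q| ≤
      ∑ s, ∑ t, ∑ v, ∑ w', |F v (q.2 t) (q.1 s) w'| := by
  classical
  have h := sum_abs_kikuchiMatrix_row_le l (fun v' w' v w => F v w v' w') q
  refine le_trans (le_of_eq ?_) h
  refine Finset.sum_congr rfl fun p _ => ?_
  simp only [kikuchiMatrix]
  congr 1
  refine Finset.sum_congr rfl fun s _ => Finset.sum_congr rfl fun t _ => ?_
  exact if_congr agreeOff_comm (if_congr agreeOff_comm rfl rfl) rfl

/-- Every tensor entry occurs once for each choice of `s`, `t` and of the remaining `l - 1` common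
entries in both tuples, always with the same value. -/
theorem card_sq_mul_kikuchi_form {V : Type*} [Fintype V] (l : ℕ) (F : V → V → V → V → ℝ)
    {y z : V → ℝ} (hy : ∀ v, y v * y v = 1) (hz : ∀ v, z v * z v = 1) :
    (Fintype.card V : ℝ) ^ 2 * ∑ p, ∑ q, kikuchiMatrix l F p q *
        ((∏ s, y (p.1 s)) * ∏ t, z (p.2 t)) * ((∏ s, y (q.1 s)) * ∏ t, z (q.2 t)) =
      (l : ℝ) ^ 2 * ((Fintype.card V : ℝ) ^ l) ^ 2 *
        ∑ v, ∑ w, ∑ v', ∑ w', F v w v' w' * (y v * z w * y v' * z w') := by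
  classical
  have h1 : ∀ p : (Fin l → V) × (Fin l → V), ∑ q, kikuchiMatrix l F p q *
        ((∏ s, y (p.1 s)) * ∏ t, z (p.2 t)) * ((∏ s, y (q.1 s)) * ∏ t, z (q.2 t)) =
      ∑ s, ∑ t, ∑ v', ∑ w, F (p.1 s) w v' (p.2 t) * (y (p.1 s) * z w * y v' * z (p.2 t)) := by
    intro p
    calc _ = ∑ q : (Fin l → V) × (Fin l → V), ∑ s, ∑ t, (if AgreeOff s p.1 q.1 then
        (if AgreeOff t p.2 q.2 then F (p.1 s) (q.2 t) (q.1 s) (p.2 t) *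
          (y (p.1 s) * z (q.2 t) * y (q.1 s) * z (p.2 t)) else 0) else 0) := by
          refine Finset.sum_congr rfl fun q _ => ?_
          rw [kikuchiMatrix, Finset.sum_mul, Finset.sum_mul]
          refine Finset.sum_congr rfl fun s _ => ?_
          rw [Finset.sum_mul, Finset.sum_mul]
          refine Finset.sum_congr rfl fun t _ => ?_
          split_ifs with hs ht
          · have e1 := prod_mul_prod_of_agreeOff hs hy
            have e2 := prod_mul_prod_of_agreeOff ht hz
            calc _ = F (p.1 s) (q.2 t) (q.1 s) (p.2 t) *
                  (((∏ s, y (p.1 s)) * ∏ s, y (q.1 s)) *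
                    ((∏ t, z (p.2 t)) * ∏ t, z (q.2 t))) := by ring
              _ = _ := by rw [e1, e2]; ring
          · simp
          · simp
      _ = _ := by
          rw [Finset.sum_comm]
          refine Finset.sum_congr rfl fun s _ => ?_
          rw [Finset.sum_comm]
          refine Finset.sum_congr rfl fun t _ => ?_
          exact sum_agreeOff_agreeOff s t p.1 p.2 fun v' w =>
            F (p.1 s) w v' (p.2 t) * (y (p.1 s) * z w * y v' * z (p.2 t))
  simp_rw [h1]
  set N : ℝ := (Fintype.card V : ℝ)
  let G : V → V → ℝ := fun v w' => ∑ v', ∑ w, F v w v' w' * (y v * z w * y v' * z w')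
  have h2 : ∀ s t : Fin l, N ^ 2 * ∑ p : (Fin l → V) × (Fin l → V), G (p.1 s) (p.2 t) =
      (N ^ l) ^ 2 * ∑ v, ∑ w', G v w' := by
    intro s t
    rw [Fintype.sum_prod_type]
    calc N ^ 2 * ∑ A : Fin l → V, ∑ B : Fin l → V, G (A s) (B t)
        = N * ∑ A : Fin l → V, N * ∑ B : Fin l → V, G (A s) (B t) := by
          rw [← Finset.mul_sum]; ring
      _ = N * ∑ A : Fin l → V, N ^ l * ∑ w', G (A s) w' := by
          simp_rw [N, card_mul_sum_apply t]
      _ = N ^ l * (N * ∑ A : Fin l → V, ∑ w', G (A s) w') := by rw [← Finset.mul_sum]; ring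
      _ = _ := by
          rw [card_mul_sum_apply s (fun v => ∑ w', G v w')]; ring
  calc _ = ∑ s : Fin l, ∑ t : Fin l,
        N ^ 2 * ∑ p : (Fin l → V) × (Fin l → V), G (p.1 s) (p.2 t) := by
        rw [Finset.sum_comm, Finset.mul_sum]
        refine Finset.sum_congr rfl fun s _ => ?_
        rw [Finset.sum_comm, Finset.mul_sum]
    _ = (l : ℝ) ^ 2 * ((N ^ l) ^ 2 * ∑ v, ∑ w', G v w') := by
        simp_rw [h2]; simp; ring
    _ = _ := by
        rw [mul_assoc]
        congr 2
        refine Finset.sum_congr rfl fun v _ => ?_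
        calc ∑ w', ∑ v', ∑ w, F v w v' w' * (y v * z w * y v' * z w')
            = ∑ v', ∑ w', ∑ w, F v w v' w' * (y v * z w * y v' * z w') := Finset.sum_comm
          _ = ∑ v', ∑ w, ∑ w', F v w v' w' * (y v * z w * y v' * z w') :=
              Finset.sum_congr rfl fun v' _ => Finset.sum_comm
          _ = _ := Finset.sum_comm

/-- The Kikuchi bound for Rademacher sums of `4`-tensors. -/
theorem expect_rademacher_four_tensor_le {ι : Type*} {V : Type u} [Fintype ι] [DecidableEq ι]
    [Fintype V] [Nonempty V] {l : ℕ} (hl : 0 < l) (F : ι → V → V → V → V → ℝ)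
    (Q Q' : ι → V → V → ℝ) {τ κ lam L D₁ D : ℝ} (hτ : 0 < τ) (hκ : 0 ≤ κ) (hlam : 0 < lam)
    (hL : 1 ≤ L) (hN : (Fintype.card V : ℝ) ≤ Real.exp L)
    (hQ0 : ∀ i v w, 0 ≤ Q i v w) (hQ0' : ∀ i v w, 0 ≤ Q' i v w)
    (hQτ : ∀ i v w, Q i v w ≤ τ) (hQτ' : ∀ i v w, Q' i v w ≤ τ)
    (hQr : ∀ i v, ∑ w, Q i v w ≤ κ) (hQr' : ∀ i v, ∑ w, Q' i v w ≤ κ)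
    (hQc : ∀ i w, ∑ v, Q i v w ≤ κ) (hQc' : ∀ i w, ∑ v, Q' i v w ≤ κ)
    (hF : ∀ i v w', ∑ v', ∑ w, |F i v w v' w'| ≤ Q i v w')
    (hF' : ∀ i v' w, ∑ v, ∑ w', |F i v w v' w'| ≤ Q' i v' w)
    (hD₁ : D₁ = 2 * κ * l / Fintype.card V + lam * τ)
    (hD : D = 2 * (κ * l) * l / Fintype.card V + lam * D₁)
    (y z : (ι → Bool) → V → ℝ) (hy : ∀ b v, y b v * y b v = 1) (hz : ∀ b v, z b v * z b v = 1) :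
    𝔼 b, ∑ i, boolSign (b i) *
        ∑ v, ∑ w, ∑ v', ∑ w', F i v w v' w' * (y b v * z b w * y b v' * z b w') ≤
      (Fintype.card V : ℝ) ^ 2 / l ^ 2 * (D * √(128 * l * L * Fintype.card ι)) +
        4 * Fintype.card ι * κ * (Fintype.card V : ℝ) ^ 3 * Real.exp (-lam) := by
  set N : ℝ := (Fintype.card V : ℝ) with hNdef
  set k : ℝ := (Fintype.card ι : ℝ) with hkdef
  have hN1 : 1 ≤ N := by rw [hNdef]; exact_mod_cast Fintype.card_pos
  have hk : 0 ≤ k := Nat.cast_nonneg _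
  have hl' : (1 : ℝ) ≤ l := by exact_mod_cast hl
  have hD₁0 : 0 ≤ D₁ := by rw [hD₁]; positivity
  have hD0 : 0 ≤ D := by rw [hD]; positivity
  have habs : ∀ a : ℝ, a * a = 1 → |a| ≤ 1 := by
    intro a ha; rw [← sq] at ha; exact (sq_le_one_iff_abs_le_one a).mp ha.le
  have hprod : ∀ (y z : V → ℝ), (∀ v, y v * y v = 1) → (∀ v, z v * z v = 1) →
      ∀ p : (Fin l → V) × (Fin l → V), |(∏ s, y (p.1 s)) * ∏ t, z (p.2 t)| ≤ 1 := by
    intro y z hy hz p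
    apply habs
    rw [mul_mul_mul_comm, ← Finset.prod_mul_distrib, ← Finset.prod_mul_distrib]
    simp [hy, hz]
  have hcard : (Fintype.card ((Fin l → V) × (Fin l → V)) : ℝ) = (N ^ l) ^ 2 := by
    simp [hNdef, sq]
  have hmain := expect_rademacher_bilinear_le_of_degrees
    -- The dimension is `N^(2l)`, so its logarithm is at most `2 * l * L`.
    (fun i => kikuchiMatrix l (F i)) (D := D) (L := 2 * l * L) hD0
    (fun i p => ∑ s, ∑ t, Q i (p.1 s) (p.2 t)) (fun i q => ∑ s, ∑ t, Q' i (q.1 s) (q.2 t))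
    (fun i p => (sum_abs_kikuchiMatrix_row_le l (F i) p).trans
      (Finset.sum_le_sum fun s _ => Finset.sum_le_sum fun t _ => hF i _ _))
    (fun i q => (sum_abs_kikuchiMatrix_col_le l (F i) q).trans
      (Finset.sum_le_sum fun s _ => Finset.sum_le_sum fun t _ => hF' i _ _))
    (by nlinarith)
    (by
      rw [hcard, ← pow_mul]
      calc N ^ (l * 2) ≤ Real.exp L ^ (l * 2) := by gcongr
        _ = _ := by rw [← Real.exp_nat_mul]; congr 1; push_cast; ring)
    (fun b p => (∏ s, y b (p.1 s)) * ∏ t, z b (p.2 t))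
    (fun b p => (∏ s, y b (p.1 s)) * ∏ t, z b (p.2 t))
    (fun b => hprod _ _ (hy b) (hz b)) (fun b => hprod _ _ (hy b) (hz b))
  set e := Real.exp (-lam)
  have herr : ∑ i, (∑ p : (Fin l → V) × (Fin l → V),
        (if D < ∑ s, ∑ t, Q i (p.1 s) (p.2 t) then ∑ s, ∑ t, Q i (p.1 s) (p.2 t) else 0) +
      ∑ q : (Fin l → V) × (Fin l → V),
        if D < ∑ s, ∑ t, Q' i (q.1 s) (q.2 t) then ∑ s, ∑ t, Q' i (q.1 s) (q.2 t) else 0) ≤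
      k * (2 * (2 * N * (N ^ l) ^ 2 * e * (l ^ 2 * κ))) := by
    calc _ ≤ ∑ _i : ι, 2 * (2 * N * (N ^ l) ^ 2 * e * (l ^ 2 * κ)) := by
          refine Finset.sum_le_sum fun i _ => ?_
          have h1 := sum_large_degree_le l (Q i) hτ hlam hκ (hQ0 i) (hQτ i) (hQr i) (hQc i) hD₁ hD
          have h2 := sum_large_degree_le l (Q' i) hτ hlam hκ (hQ0' i) (hQτ' i) (hQr' i) (hQc' i)
            hD₁ hD
          linarith
      _ = _ := by simp [hkdef]
  have hform : ∀ b, N ^ 2 * ∑ p, ∑ q, (∑ i, boolSign (b i) * kikuchiMatrix l (F i) p q) *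
        ((∏ s, y b (p.1 s)) * ∏ t, z b (p.2 t)) * ((∏ s, y b (q.1 s)) * ∏ t, z b (q.2 t)) =
      l ^ 2 * (N ^ l) ^ 2 * ∑ i, boolSign (b i) *
        ∑ v, ∑ w, ∑ v', ∑ w', F i v w v' w' * (y b v * z b w * y b v' * z b w') := by
    intro b
    have h1 := fun i => card_sq_mul_kikuchi_form l (F i) (hy b) (hz b)
    calc _ = ∑ i, boolSign (b i) * (N ^ 2 * ∑ p, ∑ q, kikuchiMatrix l (F i) p q *
        ((∏ s, y b (p.1 s)) * ∏ t, z b (p.2 t)) *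
          ((∏ s, y b (q.1 s)) * ∏ t, z b (q.2 t))) := by
          simp_rw [Finset.sum_mul, Finset.mul_sum]
          conv_rhs => rw [Finset.sum_comm]
          refine Finset.sum_congr rfl fun p _ => ?_
          conv_rhs => rw [Finset.sum_comm]
          refine Finset.sum_congr rfl fun q _ => ?_
          exact Finset.sum_congr rfl fun i _ => by ring
      _ = _ := by
          simp_rw [hNdef, h1]
          rw [Finset.mul_sum]
          exact Finset.sum_congr rfl fun i _ => by ring
  set X : (ι → Bool) → ℝ := fun b => ∑ i, boolSign (b i) *
        ∑ v, ∑ w, ∑ v', ∑ w', F i v w v' w' * (y b v * z b w * y b v' * z b w') with hX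
  have hEX : l ^ 2 * (N ^ l) ^ 2 * 𝔼 b, X b ≤ N ^ 2 * (D * √(64 * (2 * l * L) * k *
      (N ^ l) ^ 2 * (N ^ l) ^ 2) + k * (2 * (2 * N * (N ^ l) ^ 2 * e * (l ^ 2 * κ)))) := by
    rw [Finset.mul_expect]
    simp_rw [hX, ← hform]
    rw [← Finset.mul_expect]
    rw [hcard] at hmain
    refine mul_le_mul_of_nonneg_left (hmain.trans ?_) (by positivity)
    gcongr
  have hsqrt : √(64 * (2 * l * L) * k * (N ^ l) ^ 2 * (N ^ l) ^ 2) =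
      √(128 * l * L * k) * (N ^ l) ^ 2 := by
    rw [show 64 * (2 * l * L) * k * (N ^ l) ^ 2 * (N ^ l) ^ 2 =
      128 * l * L * k * ((N ^ l) ^ 2) ^ 2 by ring, Real.sqrt_mul (by positivity),
      Real.sqrt_sq (by positivity)]
  rw [hsqrt] at hEX
  have hpos : 0 < (l : ℝ) ^ 2 * (N ^ l) ^ 2 := by positivity
  rw [← mul_le_mul_iff_right₀ hpos]
  refine hEX.trans (le_of_eq ?_)
  field_simp
  ring

/-! ### Signed sums of 3-tensors with bounded slices. -/

/-- Every slice of every tensor of the family has absolute sum at most one. -/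
structure SliceBounded {ι V : Type*} [Fintype V] (T : ι → V → V → V → ℝ) : Prop where
  fst : ∀ i u, ∑ v, ∑ w, |T i u v w| ≤ 1
  snd : ∀ i v, ∑ u, ∑ w, |T i u v w| ≤ 1
  thd : ∀ i w, ∑ u, ∑ v, |T i u v w| ≤ 1

/-- The value of the random signed sum of the tensors `T i` at the vectors `x`, `y`, `z`. -/
noncomputable def signedForm {ι V : Type*} [Fintype ι] [Fintype V] (T : ι → V → V → V → ℝ)
    (b : ι → Bool) (x y z : V → ℝ) : ℝ :=
  ∑ i, boolSign (b i) * ∑ u, ∑ v, ∑ w, T i u v w * (x u * y v * z w)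

theorem SliceBounded.swap {ι V : Type*} [Fintype V] {T : ι → V → V → V → ℝ}
    (h : SliceBounded T) : SliceBounded fun i u w v => T i u v w :=
  ⟨fun i u => by rw [Finset.sum_comm]; exact h.fst i u, h.thd, h.snd⟩

theorem SliceBounded.mono {ι V : Type*} [Fintype V] {T T' : ι → V → V → V → ℝ}
    (h : SliceBounded T) (hT : ∀ i u v w, |T' i u v w| ≤ |T i u v w|) : SliceBounded T' :=
  ⟨fun i u => (Finset.sum_le_sum fun v _ => Finset.sum_le_sum fun w _ => hT i u v w).trans
      (h.fst i u),
    fun i v => (Finset.sum_le_sum fun u _ => Finset.sum_le_sum fun w _ => hT i u v w).trans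
      (h.snd i v),
    fun i w => (Finset.sum_le_sum fun u _ => Finset.sum_le_sum fun v _ => hT i u v w).trans
      (h.thd i w)⟩

theorem signedForm_swap {ι V : Type*} [Fintype ι] [Fintype V] (T : ι → V → V → V → ℝ)
    (b : ι → Bool) (x y z : V → ℝ) :
    signedForm (fun i u w v => T i u v w) b x z y = signedForm T b x y z := by
  unfold signedForm
  refine Finset.sum_congr rfl fun i _ => ?_
  congr 1
  refine Finset.sum_congr rfl fun u _ => ?_
  rw [Finset.sum_comm]
  exact Finset.sum_congr rfl fun v _ => Finset.sum_congr rfl fun w _ => by ring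

theorem signedForm_add {ι V : Type*} [Fintype ι] [Fintype V] (T T' : ι → V → V → V → ℝ)
    (b : ι → Bool) (x y z : V → ℝ) :
    signedForm (fun i u v w => T i u v w + T' i u v w) b x y z =
      signedForm T b x y z + signedForm T' b x y z := by
  simp only [signedForm, add_mul, Finset.sum_add_distrib, mul_add]

/-- Tensors supported on few pairs in the first two modes contribute little. -/
theorem expect_signedForm_le_of_support {ι : Type*} {V : Type u} [Fintype ι] [DecidableEq ι]
    [Fintype V] {T : ι → V → V → V → ℝ} (hT : SliceBounded T) (H : Finset (V × V))
    (hH : ∀ i u v w, (u, v) ∉ H → T i u v w = 0) {L : ℝ} (hL : 1 ≤ L)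
    (hN : (Fintype.card V : ℝ) ≤ Real.exp L) (x y z : (ι → Bool) → V → ℝ)
    (hx : ∀ b v, |x b v| ≤ 1) (hy : ∀ b v, |y b v| ≤ 1) (hz : ∀ b v, |z b v| ≤ 1) :
    𝔼 b, signedForm T b (x b) (y b) (z b) ≤
      √(64 * L * Fintype.card ι * #H * Fintype.card V) := by
  classical
  -- The first two modes are flattened into a row index in `H`; the slice bounds make all row and
  -- column sums at most 1.
  have h := expect_rademacher_bilinear_le (W := H) (fun i p w => T i p.1.1 p.1.2 w) zero_le_one
    (L := L) ?_ ?_ hL hN (fun b p => x b p.1.1 * y b p.1.2) z ?_ hz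
  · rw [one_mul, Fintype.card_coe] at h
    refine le_trans (le_of_eq ?_) h
    refine Finset.expect_congr rfl fun b _ => ?_
    have h1 : ∀ i, ∑ u, ∑ v, ∑ w, T i u v w * (x b u * y b v * z b w) =
        ∑ p : H, ∑ w, T i p.1.1 p.1.2 w * (x b p.1.1 * y b p.1.2 * z b w) := by
      intro i
      rw [← Fintype.sum_prod_type'
        (f := fun u v => ∑ w, T i u v w * (x b u * y b v * z b w))]
      rw [Finset.sum_coe_sort H
        (fun p => ∑ w, T i p.1 p.2 w * (x b p.1 * y b p.2 * z b w))]
      refine (Finset.sum_subset (Finset.subset_univ H) ?_).symm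
      intro p _ hp
      exact Finset.sum_eq_zero fun w _ => by rw [hH i p.1 p.2 w hp, zero_mul]
    simp only [signedForm, h1, Finset.sum_mul, Finset.mul_sum]
    rw [Finset.sum_comm]
    refine Finset.sum_congr rfl fun p _ => ?_
    rw [Finset.sum_comm]
    exact Finset.sum_congr rfl fun w _ => Finset.sum_congr rfl fun i _ => by ring
  · intro i p
    exact (Finset.single_le_sum (f := fun v => ∑ w, |T i p.1.1 v w|)
      (fun v _ => Finset.sum_nonneg fun w _ => abs_nonneg _) (Finset.mem_univ _)).trans
        (hT.fst i p.1.1)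
  · intro i w
    rw [Finset.sum_coe_sort H (fun p => |T i p.1 p.2 w|)]
    refine le_trans ?_ (hT.thd i w)
    rw [← Fintype.sum_prod_type' (f := fun u v => |T i u v w|)]
    exact Finset.sum_le_sum_of_subset_of_nonneg (Finset.subset_univ H) fun _ _ _ => abs_nonneg _
  · intro b p
    rw [abs_mul]
    exact mul_le_one₀ (hx _ _) (abs_nonneg _) (hy _ _)

/-! ### Decoupling and the light part. -/

/-- Averaging over a random cut of the index set decouples a double sum. -/
theorem sum_sum_eq_diag_add_expect_cut {ι : Type*} [Fintype ι] [DecidableEq ι] (c : ι → ι → ℝ) :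
    ∑ i, ∑ j, c i j = ∑ i, c i i +
      4 * 𝔼 l : ι → Bool, ∑ i, ∑ j, (if l i = true ∧ l j = false then c i j else 0) := by
  -- A random cut separates two distinct indices in the given orientation with probability 1/4.
  have h1 : ∀ i j, 𝔼 l : ι → Bool, (if l i = true ∧ l j = false then c i j else 0) =
      if i = j then 0 else c i j / 4 := by
    intro i j
    by_cases hij : i = j
    · subst hij
      rw [if_pos rfl]
      refine (Finset.expect_congr rfl fun l _ => ?_).trans (Finset.expect_const_zero _)
      rw [if_neg]; rintro ⟨h, h'⟩; rw [h] at h'; cases h'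
    · rw [if_neg hij]
      let g : ι → Bool → ℝ := fun m β =>
        (if m = i then (if β then (1 : ℝ) else 0) else 1) *
          (if m = j then (if β then (0 : ℝ) else 1) else 1)
      have h3 : ∀ m : ι, (g m true + g m false) / 2 =
          (if m = i then (1 / 2 : ℝ) else 1) * (if m = j then (1 / 2 : ℝ) else 1) := by
        intro m
        by_cases hi : m = i
        · simp [g, hi, hij]
        · by_cases hj : m = j
          · simp [g, hj, Ne.symm hij]
          · simp [g, hi, hj]
      have h2 := expect_prod_apply g
      simp_rw [h3, g, Finset.prod_mul_distrib, Finset.prod_ite_eq', Finset.mem_univ, if_true] at h2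
      calc _ = 𝔼 l : ι → Bool, c i j * ((if l i = true then (1 : ℝ) else 0) *
            (if l j = true then (0 : ℝ) else 1)) := by
            refine Finset.expect_congr rfl fun l _ => ?_
            cases l i <;> cases l j <;> simp
        _ = _ := by rw [← Finset.mul_expect, h2]; ring
  simp_rw [Finset.expect_sum_comm, h1]
  rw [Finset.mul_sum, ← Finset.sum_add_distrib]
  refine Finset.sum_congr rfl fun i _ => ?_
  rw [Finset.mul_sum, ← Finset.add_sum_erase _ _ (Finset.mem_univ i),
    ← Finset.add_sum_erase Finset.univ (fun j => 4 * if i = j then 0 else c i j / 4)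
      (Finset.mem_univ i)]
  simp only [if_true, mul_zero, zero_add]
  congr 1
  refine Finset.sum_congr rfl fun j hj => ?_
  rw [if_neg (Finset.ne_of_mem_erase hj).symm]; ring

/-- The coordinates in the cut `l` are resampled independently of the others. -/
theorem expect_eq_expect_expect_cut {ι : Type*} [Fintype ι] [DecidableEq ι] (l : ι → Bool)
    (g : (ι → Bool) → ℝ) :
    𝔼 b, g b = 𝔼 β : ι → Bool, 𝔼 c : ι → Bool, g (fun i => if l i then c i else β i) := by
  -- `σ` exchanges two independent copies outside the cut, an involution of the product space.
  let σ : (ι → Bool) × (ι → Bool) → (ι → Bool) × (ι → Bool) := fun p =>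
    (fun i => if l i then p.1 i else p.2 i, fun i => if l i then p.2 i else p.1 i)
  have hσ : Function.Involutive σ := by
    intro p
    ext i <;> simp only [σ] <;> split_ifs <;> rfl
  have h1 : 𝔼 p : (ι → Bool) × (ι → Bool), g (σ p).1 =
      𝔼 p : (ι → Bool) × (ι → Bool), g p.1 :=
    Fintype.expect_equiv hσ.toPerm _ _ fun p => rfl
  rw [← Finset.univ_product_univ, Finset.expect_product, Finset.expect_product] at h1
  simp only [Fintype.expect_const] at h1
  rw [Finset.expect_comm] at h1
  exact h1.symm

/-- The weighted number of ways to join `a` to `b` through a common first coordinate. -/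
noncomputable def pairDegree {ι V : Type*} [Fintype ι] [Fintype V] (T : ι → V → V → V → ℝ)
    (i : ι) (a b : V) : ℝ :=
  ∑ j, ∑ u, (∑ c, |T i u a c|) * ∑ c, |T j u c b|

theorem pairDegree_nonneg {ι V : Type*} [Fintype ι] [Fintype V] (T : ι → V → V → V → ℝ)
    (i : ι) (a b : V) : 0 ≤ pairDegree T i a b :=
  Finset.sum_nonneg fun _ _ => Finset.sum_nonneg fun _ _ =>
    mul_nonneg (Finset.sum_nonneg fun _ _ => abs_nonneg _)
      (Finset.sum_nonneg fun _ _ => abs_nonneg _)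

/-- For fixed `u`, the sum over `j` and `c` is at most `τ` by lightness of the pair `(u,b)`; the
remaining weight is the slice of `T i` at `a`. -/
theorem pairDegree_le {ι V : Type*} [Fintype ι] [Fintype V] {T : ι → V → V → V → ℝ}
    (hT : SliceBounded T) {τ : ℝ} (hτ : 0 ≤ τ) (h13 : ∀ u w, ∑ i, ∑ v, |T i u v w| ≤ τ)
    (i : ι) (a b : V) : pairDegree T i a b ≤ τ := by
  rw [pairDegree, Finset.sum_comm]
  calc ∑ u, ∑ j, (∑ c, |T i u a c|) * ∑ c, |T j u c b|
      = ∑ u, (∑ c, |T i u a c|) * ∑ j, ∑ c, |T j u c b| := by simp_rw [Finset.mul_sum]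
    _ ≤ ∑ u, (∑ c, |T i u a c|) * τ := Finset.sum_le_sum fun u _ =>
        mul_le_mul_of_nonneg_left (h13 u b) (Finset.sum_nonneg fun _ _ => abs_nonneg _)
    _ ≤ 1 * τ := by
        rw [← Finset.sum_mul]; exact mul_le_mul_of_nonneg_right (hT.snd i a) hτ
    _ = τ := one_mul τ

theorem sum_pairDegree_right_le {ι V : Type*} [Fintype ι] [Fintype V] {T : ι → V → V → V → ℝ}
    (hT : SliceBounded T) (i : ι) (a : V) : ∑ b, pairDegree T i a b ≤ Fintype.card ι := by
  calc ∑ b, pairDegree T i a b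
      = ∑ j, ∑ u, (∑ c, |T i u a c|) * ∑ b, ∑ c, |T j u c b| := by
        simp only [pairDegree]
        rw [Finset.sum_comm]
        refine Finset.sum_congr rfl fun j _ => ?_
        rw [Finset.sum_comm]
        simp_rw [← Finset.mul_sum]
    _ ≤ ∑ _j : ι, (1 : ℝ) := by
        refine Finset.sum_le_sum fun j _ => ?_
        refine le_trans (Finset.sum_le_sum fun u _ => ?_) (hT.snd i a)
        refine mul_le_of_le_one_right (Finset.sum_nonneg fun _ _ => abs_nonneg _) ?_
        rw [Finset.sum_comm]; exact hT.fst j u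
    _ = _ := by simp

theorem sum_pairDegree_left_le {ι V : Type*} [Fintype ι] [Fintype V] {T : ι → V → V → V → ℝ}
    (hT : SliceBounded T) (i : ι) (b : V) : ∑ a, pairDegree T i a b ≤ Fintype.card ι := by
  calc ∑ a, pairDegree T i a b
      = ∑ j, ∑ u, (∑ a, ∑ c, |T i u a c|) * ∑ c, |T j u c b| := by
        simp only [pairDegree]
        rw [Finset.sum_comm]
        refine Finset.sum_congr rfl fun j _ => ?_
        rw [Finset.sum_comm]
        simp_rw [← Finset.sum_mul]
    _ ≤ ∑ _j : ι, (1 : ℝ) := by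
        refine Finset.sum_le_sum fun j _ => ?_
        refine le_trans (Finset.sum_le_sum fun u _ => ?_) (hT.thd j b)
        exact mul_le_of_le_one_left (Finset.sum_nonneg fun _ _ => abs_nonneg _) (hT.fst i u)
    _ = _ := by simp

theorem sum_sum_abs_le_pairDegree {ι V : Type*} [Fintype ι] [Fintype V]
    (T : ι → V → V → V → ℝ) (i : ι) {F : V → V → V → V → ℝ}
    (hF : ∀ v w v' w', |F v w v' w'| ≤ ∑ j, ∑ u, |T i u v w| * |T j u v' w'|) (v w' : V) :
    ∑ v', ∑ w, |F v w v' w'| ≤ pairDegree T i v w' := by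
  calc ∑ v', ∑ w, |F v w v' w'| ≤ ∑ v', ∑ w, ∑ j, ∑ u, |T i u v w| * |T j u v' w'| :=
        Finset.sum_le_sum fun v' _ => Finset.sum_le_sum fun w _ => hF v w v' w'
    _ = ∑ v', ∑ j, ∑ u, (∑ w, |T i u v w|) * |T j u v' w'| := by
        refine Finset.sum_congr rfl fun v' _ => ?_
        rw [Finset.sum_comm]
        refine Finset.sum_congr rfl fun j _ => ?_
        rw [Finset.sum_comm]
        simp_rw [Finset.sum_mul]
    _ = _ := by
        rw [Finset.sum_comm, pairDegree]
        refine Finset.sum_congr rfl fun j _ => ?_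
        rw [Finset.sum_comm]
        simp_rw [Finset.mul_sum]

theorem sum_slice_mul_slice {V : Type*} [Fintype V] (T T' : V → V → V → ℝ) (y z : V → ℝ) :
    ∑ u, (∑ v, ∑ w, T u v w * (y v * z w)) * (∑ v', ∑ w', T' u v' w' * (y v' * z w')) =
      ∑ v, ∑ w, ∑ v', ∑ w', (∑ u, T u v w * T' u v' w') * (y v * z w * y v' * z w') := by
  simp_rw [Finset.sum_mul, Finset.mul_sum]
  rw [Finset.sum_comm]
  refine Finset.sum_congr rfl fun v _ => ?_
  rw [Finset.sum_comm]
  refine Finset.sum_congr rfl fun w _ => ?_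
  rw [Finset.sum_comm]
  refine Finset.sum_congr rfl fun v' _ => ?_
  rw [Finset.sum_comm]
  exact Finset.sum_congr rfl fun w' _ => Finset.sum_congr rfl fun u _ => by ring

theorem sum_four_comm {V J : Type*} [Fintype V] [Fintype J] (g : J → V → V → V → V → ℝ) :
    ∑ v, ∑ w, ∑ v', ∑ w', ∑ j, g j v w v' w' = ∑ j, ∑ v, ∑ w, ∑ v', ∑ w', g j v w v' w' := by
  rw [Finset.sum_comm (γ := J)]
  refine Finset.sum_congr rfl fun v _ => ?_
  rw [Finset.sum_comm (γ := J)]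
  refine Finset.sum_congr rfl fun w _ => ?_
  rw [Finset.sum_comm (γ := J)]
  refine Finset.sum_congr rfl fun v' _ => ?_
  rw [Finset.sum_comm (γ := J)]

/-- The off-diagonal part of the squared form, restricted to a cut and with the signs outside the
cut frozen, is a Rademacher sum of `4`-tensors. -/
theorem expect_cut_le {ι : Type*} {V : Type u} [Fintype ι] [DecidableEq ι] [Fintype V] [Nonempty V]
    {T : ι → V → V → V → ℝ} (hT : SliceBounded T) {τ lam L D₁ D : ℝ} {l : ℕ} (hl : 0 < l)
    (hτ : 0 < τ) (h12 : ∀ u v, ∑ i, ∑ w, |T i u v w| ≤ τ)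
    (h13 : ∀ u w, ∑ i, ∑ v, |T i u v w| ≤ τ) (hlam : 0 < lam) (hL : 1 ≤ L)
    (hN : (Fintype.card V : ℝ) ≤ Real.exp L)
    (hD₁ : D₁ = 2 * Fintype.card ι * l / Fintype.card V + lam * τ)
    (hD : D = 2 * (Fintype.card ι * l) * l / Fintype.card V + lam * D₁)
    (y z : (ι → Bool) → V → ℝ) (hy : ∀ b v, y b v * y b v = 1) (hz : ∀ b v, z b v * z b v = 1)
    (s : ι → Bool) :
    𝔼 b : ι → Bool, ∑ i, ∑ j, (if s i = true ∧ s j = false then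
        boolSign (b i) * boolSign (b j) * ∑ u, (∑ v, ∑ w, T i u v w * (y b v * z b w)) *
          (∑ v, ∑ w, T j u v w * (y b v * z b w)) else 0) ≤
      (Fintype.card V : ℝ) ^ 2 / l ^ 2 * (D * √(128 * l * L * Fintype.card ι)) +
        4 * Fintype.card ι * Fintype.card ι * (Fintype.card V : ℝ) ^ 3 * Real.exp (-lam) := by
  rw [expect_eq_expect_expect_cut s]
  refine Finset.expect_le Finset.univ_nonempty fun β _ => ?_
  let φ : (ι → Bool) → (ι → Bool) := fun c i => if s i then c i else β i
  -- With the signs `β` outside the cut frozen, the sum over `j` is absorbed in the tensor attached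
  -- to `i`, so the form is linear in the remaining signs.
  let F : ι → V → V → V → V → ℝ := fun i v w v' w' => if s i = true then
    ∑ j, (if s j = false then boolSign (β j) * ∑ u, T i u v w * T j u v' w' else 0) else 0
  have hF : ∀ i v w v' w', |F i v w v' w'| ≤ ∑ j, ∑ u, |T i u v w| * |T j u v' w'| := by
    intro i v w v' w'
    have h0 : 0 ≤ ∑ j, ∑ u, |T i u v w| * |T j u v' w'| :=
      Finset.sum_nonneg fun j _ => Finset.sum_nonneg fun u _ => by positivity
    simp only [F]
    split_ifs
    · refine (Finset.abs_sum_le_sum_abs _ _).trans (Finset.sum_le_sum fun j _ => ?_)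
      have h1 : 0 ≤ ∑ u, |T i u v w| * |T j u v' w'| :=
        Finset.sum_nonneg fun u _ => by positivity
      split_ifs
      · rw [abs_mul, abs_boolSign, one_mul]
        refine (Finset.abs_sum_le_sum_abs _ _).trans (le_of_eq ?_)
        simp_rw [abs_mul]
      · simpa using h1
    · simpa using h0
  -- Row degrees are pair degrees of `T`, column degrees those of `T` with its last two modes
  -- exchanged; hence lightness is needed for both `(u,w)` and `(u,v)`. Each index `j` adds at most
  -- 1 to a marginal of a pair degree, so `κ` is the number of indices.
  have key := expect_rademacher_four_tensor_le hl F (fun i v w' => pairDegree T i v w')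
    (fun i v' w => pairDegree (fun i u w v => T i u v w) i w v') hτ
    (Nat.cast_nonneg (Fintype.card ι)) hlam hL hN
    (fun _ _ _ => pairDegree_nonneg _ _ _ _) (fun _ _ _ => pairDegree_nonneg _ _ _ _)
    (fun _ _ _ => pairDegree_le hT hτ.le h13 _ _ _)
    (fun _ _ _ => pairDegree_le hT.swap hτ.le h12 _ _ _)
    (fun _ _ => sum_pairDegree_right_le hT _ _)
    (fun _ _ => sum_pairDegree_left_le hT.swap _ _)
    (fun _ _ => sum_pairDegree_left_le hT _ _)
    (fun _ _ => sum_pairDegree_right_le hT.swap _ _)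
    (fun i v w' => sum_sum_abs_le_pairDegree T i (hF i) v w')
    (fun i v' w => by
      rw [Finset.sum_comm]
      exact sum_sum_abs_le_pairDegree (fun i u w v => T i u v w) i
        (F := fun w v w' v' => F i v w v' w') (fun w v w' v' => hF i v w v' w') w v')
    hD₁ hD (fun c => y (φ c)) (fun c => z (φ c)) (fun c => hy _) (fun c => hz _)
  refine le_trans (le_of_eq ?_) key
  refine Finset.expect_congr rfl fun c _ => ?_
  refine Finset.sum_congr rfl fun i _ => ?_
  by_cases hi : s i = true
  · simp only [F, hi, true_and, if_true]
    conv_rhs => simp only [Finset.sum_mul]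
    rw [sum_four_comm, Finset.mul_sum]
    refine Finset.sum_congr rfl fun j _ => ?_
    by_cases hj : s j = false
    · rw [sum_slice_mul_slice]
      simp only [hj, φ, if_true, Bool.false_eq_true, if_false]
      rw [mul_assoc, Finset.mul_sum]
      congr 1
      refine Finset.sum_congr rfl fun v _ => ?_
      rw [Finset.mul_sum]
      refine Finset.sum_congr rfl fun w _ => ?_
      rw [Finset.mul_sum]
      refine Finset.sum_congr rfl fun v' _ => ?_
      rw [Finset.mul_sum]
      exact Finset.sum_congr rfl fun w' _ => (mul_assoc _ _ _).symm
    · simp [hj]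
  · simp [F, hi]

/-- Cauchy–Schwarz in `u` eliminates `x` and leaves inner products of the slices of `T i` and `T j`.
The diagonal costs at most `k N`; the rest is decoupled by a random cut. -/
theorem expect_signedForm_sq_le_of_light {ι : Type*} {V : Type u} [Fintype ι] [DecidableEq ι]
    [Fintype V] [Nonempty V]
    {T : ι → V → V → V → ℝ} (hT : SliceBounded T) {τ lam L D₁ D : ℝ} {l : ℕ} (hl : 0 < l)
    (hτ : 0 < τ) (h12 : ∀ u v, ∑ i, ∑ w, |T i u v w| ≤ τ)
    (h13 : ∀ u w, ∑ i, ∑ v, |T i u v w| ≤ τ) (hlam : 0 < lam) (hL : 1 ≤ L)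
    (hN : (Fintype.card V : ℝ) ≤ Real.exp L)
    (hD₁ : D₁ = 2 * Fintype.card ι * l / Fintype.card V + lam * τ)
    (hD : D = 2 * (Fintype.card ι * l) * l / Fintype.card V + lam * D₁)
    (x y z : (ι → Bool) → V → ℝ) (hx : ∀ b v, x b v * x b v = 1)
    (hy : ∀ b v, y b v * y b v = 1) (hz : ∀ b v, z b v * z b v = 1) :
    (𝔼 b, signedForm T b (x b) (y b) (z b)) ^ 2 ≤
      Fintype.card V * (Fintype.card ι * Fintype.card V +
        4 * ((Fintype.card V : ℝ) ^ 2 / l ^ 2 * (D * √(128 * l * L * Fintype.card ι)) +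
        4 * Fintype.card ι * Fintype.card ι * (Fintype.card V : ℝ) ^ 3 * Real.exp (-lam))) := by
  set R := (Fintype.card V : ℝ) ^ 2 / l ^ 2 * (D * √(128 * l * L * Fintype.card ι)) +
        4 * Fintype.card ι * Fintype.card ι * (Fintype.card V : ℝ) ^ 3 * Real.exp (-lam)
  let t : ι → (ι → Bool) → V → ℝ := fun i b u => ∑ v, ∑ w, T i u v w * (y b v * z b w)
  have habs : ∀ a : ℝ, a * a = 1 → |a| = 1 := by
    intro a ha; rcases mul_self_eq_one_iff.mp ha with h | h <;> simp [h]
  have ht : ∀ i b u, t i b u * t i b u ≤ 1 := by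
    intro i b u
    have h1 : |t i b u| ≤ 1 := by
      refine le_trans ?_ (hT.fst i u)
      refine (Finset.abs_sum_le_sum_abs _ _).trans (Finset.sum_le_sum fun v _ => ?_)
      refine (Finset.abs_sum_le_sum_abs _ _).trans (Finset.sum_le_sum fun w _ => ?_)
      rw [abs_mul, abs_mul, habs _ (hy b v), habs _ (hz b w), mul_one, mul_one]
    rw [← sq]; exact (sq_le_one_iff_abs_le_one _).mpr h1
  have hform : ∀ b, signedForm T b (x b) (y b) (z b) =
      x b ⬝ᵥ fun u => ∑ i, boolSign (b i) * t i b u := by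
    intro b
    simp only [signedForm, dotProduct, t, Finset.mul_sum]
    rw [Finset.sum_comm]
    refine Finset.sum_congr rfl fun u _ => Finset.sum_congr rfl fun i _ =>
      Finset.sum_congr rfl fun v _ => Finset.sum_congr rfl fun w _ => by ring
  have hsq : ∀ b, signedForm T b (x b) (y b) (z b) ^ 2 ≤ Fintype.card V *
      (Fintype.card ι * Fintype.card V + 4 * 𝔼 s : ι → Bool, ∑ i, ∑ j,
        (if s i = true ∧ s j = false then
          boolSign (b i) * boolSign (b j) * ∑ u, t i b u * t j b u else 0)) := by
    intro b
    have hxx : x b ⬝ᵥ x b = Fintype.card V := by simp [dotProduct, hx]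
    rw [hform]
    refine (sq_dotProduct_le _ _).trans ?_
    rw [hxx]
    refine mul_le_mul_of_nonneg_left ?_ (Nat.cast_nonneg _)
    have h1 : ((fun u => ∑ i, boolSign (b i) * t i b u) ⬝ᵥ
        fun u => ∑ i, boolSign (b i) * t i b u) =
        ∑ i, ∑ j, boolSign (b i) * boolSign (b j) * ∑ u, t i b u * t j b u := by
      simp only [dotProduct, Finset.sum_mul_sum]
      simp_rw [Finset.mul_sum]
      rw [Finset.sum_comm]
      refine Finset.sum_congr rfl fun i _ => ?_
      rw [Finset.sum_comm]
      exact Finset.sum_congr rfl fun j _ => Finset.sum_congr rfl fun u _ => by ring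
    rw [h1, sum_sum_eq_diag_add_expect_cut]
    gcongr
    calc ∑ i, boolSign (b i) * boolSign (b i) * ∑ u, t i b u * t i b u
        ≤ ∑ _i : ι, ∑ _u : V, (1 : ℝ) := by
          refine Finset.sum_le_sum fun i _ => ?_
          rw [boolSign_sq, one_mul]
          exact Finset.sum_le_sum fun u _ => ht i b u
      _ = _ := by simp
  calc (𝔼 b, signedForm T b (x b) (y b) (z b)) ^ 2
      ≤ 𝔼 b, signedForm T b (x b) (y b) (z b) ^ 2 := expect_even_pow_le _ even_two
    _ ≤ _ := Finset.expect_le_expect fun b _ => hsq b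
    _ = Fintype.card V * (Fintype.card ι * Fintype.card V + 4 * 𝔼 s : ι → Bool, 𝔼 b : ι → Bool,
        ∑ i, ∑ j, (if s i = true ∧ s j = false then
          boolSign (b i) * boolSign (b j) * ∑ u, t i b u * t j b u else 0)) := by
        rw [← Finset.mul_expect, Finset.expect_add_distrib, Fintype.expect_const]
        congr 2
        rw [← Finset.mul_expect]
        congr 1
        rw [Finset.expect_comm]
    _ ≤ _ := by
        gcongr
        refine Finset.expect_le Finset.univ_nonempty fun s _ => ?_
        exact expect_cut_le hT hl hτ h12 h13 hlam hL hN hD₁ hD y z hy hz s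

/-! ### Heavy pairs. -/

theorem card_mul_le_of_lt_sum {ι V : Type*} [Fintype ι] [Fintype V] {T : ι → V → V → V → ℝ}
    (hT : SliceBounded T) (τ : ℝ) (H : Finset (V × V))
    (hH : ∀ p ∈ H, τ < ∑ i, ∑ w, |T i p.1 p.2 w|) :
    #H * τ ≤ Fintype.card ι * Fintype.card V := by
  rw [← nsmul_eq_mul]
  calc #H • τ ≤ ∑ p ∈ H, ∑ i, ∑ w, |T i p.1 p.2 w| :=
        Finset.card_nsmul_le_sum _ _ _ fun p hp => (hH p hp).le
    _ ≤ ∑ p : V × V, ∑ i, ∑ w, |T i p.1 p.2 w| :=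
        Finset.sum_le_sum_of_subset_of_nonneg (Finset.subset_univ H) fun _ _ _ =>
          Finset.sum_nonneg fun _ _ => Finset.sum_nonneg fun _ _ => abs_nonneg _
    _ = ∑ i, ∑ u, ∑ v, ∑ w, |T i u v w| := by
        rw [Finset.sum_comm]
        exact Finset.sum_congr rfl fun i _ =>
          Fintype.sum_prod_type' (f := fun u v => ∑ w, |T i u v w|)
    _ ≤ ∑ _i : ι, ∑ _u : V, (1 : ℝ) :=
        Finset.sum_le_sum fun i _ => Finset.sum_le_sum fun u _ => hT.fst i u
    _ = _ := by simp

/-- Pairs of the first two modes of large degree contribute little. -/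
theorem expect_signedForm_le_of_heavy {ι : Type*} {V : Type u} [Fintype ι] [DecidableEq ι]
    [Fintype V] {T T' : ι → V → V → V → ℝ} (hT : SliceBounded T) (hT' : SliceBounded T') {L η : ℝ}
    (hL : 1 ≤ L) (hη : 0 < η) (hN : (Fintype.card V : ℝ) ≤ Real.exp L)
    (hH : ∀ u v, ∑ i, ∑ w, |T i u v w| ≤ 1024 * L / η ^ 2 → ∀ i w, T' i u v w = 0)
    (x y z : (ι → Bool) → V → ℝ)
    (hx : ∀ b v, |x b v| ≤ 1) (hy : ∀ b v, |y b v| ≤ 1) (hz : ∀ b v, |z b v| ≤ 1) :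
    𝔼 b, signedForm T' b (x b) (y b) (z b) ≤ η * Fintype.card ι * Fintype.card V / 4 := by
  classical
  -- By Markov `|H| ≤ kNη²/(1024 L)`, and `64/1024 = (1/4)²` gives the final factor.
  let H : Finset (V × V) := {p | 1024 * L / η ^ 2 < ∑ i, ∑ w, |T i p.1 p.2 w|}
  have hcard := card_mul_le_of_lt_sum hT (1024 * L / η ^ 2) H (by simp [H])
  refine (expect_signedForm_le_of_support hT' H ?_ hL hN x y z hx hy hz).trans ?_
  · intro i u v w h
    exact hH u v (by simpa [H] using h) i w
  · refine Real.sqrt_le_iff.mpr ⟨by positivity, ?_⟩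
    set k : ℝ := (Fintype.card ι : ℝ)
    set N : ℝ := (Fintype.card V : ℝ)
    have h1 : (#H : ℝ) * (1024 * L) ≤ k * N * η ^ 2 := by
      rw [mul_div_assoc', div_le_iff₀ (by positivity)] at hcard
      exact hcard
    have h2 : 0 ≤ k * N := by positivity
    nlinarith [mul_le_mul_of_nonneg_left h1 h2]

/-! ### Choice of parameters and the cubic bound for tensors. -/

theorem exists_sign_dotProduct_ge {V : Type*} [Fintype V] (c x : V → ℝ) (hx : ∀ v, |x v| ≤ 1) :
    ∃ x' : V → ℝ, (∀ v, x' v * x' v = 1) ∧ ∑ v, x v * c v ≤ ∑ v, x' v * c v := by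
  refine ⟨fun v => if 0 ≤ c v then 1 else -1, fun v => by
    dsimp only; split_ifs <;> norm_num,
    Finset.sum_le_sum fun v _ => ?_⟩
  have h := abs_le.mp (hx v)
  dsimp only
  split_ifs with hc
  · nlinarith
  · push Not at hc; nlinarith

/-- A trilinear form on the cube is at most its value at some vertices. -/
theorem exists_sign_signedForm_ge {ι V : Type*} [Fintype ι] [Fintype V]
    (T : ι → V → V → V → ℝ) (b : ι → Bool) (x y z : V → ℝ) (hx : ∀ v, |x v| ≤ 1)
    (hy : ∀ v, |y v| ≤ 1) (hz : ∀ v, |z v| ≤ 1) :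
    ∃ x' y' z' : V → ℝ, (∀ v, x' v * x' v = 1) ∧ (∀ v, y' v * y' v = 1) ∧
      (∀ v, z' v * z' v = 1) ∧ signedForm T b x y z ≤ signedForm T b x' y' z' := by
  have e1 : ∀ x y z : V → ℝ, signedForm T b x y z =
      ∑ u, x u * ∑ i, boolSign (b i) * ∑ v, ∑ w, T i u v w * (y v * z w) := by
    intro x y z
    simp only [signedForm, Finset.mul_sum]
    rw [Finset.sum_comm]
    exact Finset.sum_congr rfl fun u _ => Finset.sum_congr rfl fun i _ =>
      Finset.sum_congr rfl fun v _ => Finset.sum_congr rfl fun w _ => by ring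
  have e2 : ∀ x y z : V → ℝ, signedForm T b x y z =
      ∑ v, y v * ∑ i, boolSign (b i) * ∑ u, ∑ w, T i u v w * (x u * z w) := by
    intro x y z
    simp only [signedForm, Finset.mul_sum]
    conv_rhs => rw [Finset.sum_comm]
    refine Finset.sum_congr rfl fun i _ => ?_
    rw [Finset.sum_comm]
    exact Finset.sum_congr rfl fun v _ => Finset.sum_congr rfl fun u _ =>
      Finset.sum_congr rfl fun w _ => by ring
  have e3 : ∀ x y z : V → ℝ, signedForm T b x y z =
      ∑ w, z w * ∑ i, boolSign (b i) * ∑ u, ∑ v, T i u v w * (x u * y v) := by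
    intro x y z
    simp only [signedForm, Finset.mul_sum]
    conv_rhs => rw [Finset.sum_comm]
    refine Finset.sum_congr rfl fun i _ => ?_
    conv_rhs => rw [Finset.sum_comm]
    refine Finset.sum_congr rfl fun u _ => ?_
    rw [Finset.sum_comm]
    exact Finset.sum_congr rfl fun w _ => Finset.sum_congr rfl fun v _ => by ring
  -- The form is linear in each argument separately, so the three vectors are rounded one at a time.
  obtain ⟨x', hx', h1⟩ := exists_sign_dotProduct_ge
    (fun u => ∑ i, boolSign (b i) * ∑ v, ∑ w, T i u v w * (y v * z w)) x hx
  obtain ⟨y', hy', h2⟩ := exists_sign_dotProduct_ge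
    (fun v => ∑ i, boolSign (b i) * ∑ u, ∑ w, T i u v w * (x' u * z w)) y hy
  obtain ⟨z', hz', h3⟩ := exists_sign_dotProduct_ge
    (fun w => ∑ i, boolSign (b i) * ∑ u, ∑ v, T i u v w * (x' u * y' v)) z hz
  refine ⟨x', y', z', hx', hy', hz', ?_⟩
  calc signedForm T b x y z ≤ signedForm T b x' y z := by rw [e1, e1]; exact h1
    _ ≤ signedForm T b x' y' z := by rw [e2, e2]; exact h2
    _ ≤ signedForm T b x' y' z' := by rw [e3, e3]; exact h3

/-- With `lam = 12 L` the atypical tuples are negligible: `N²` and `η⁻²` cost `e^(2L)` each and the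
constant 256 at most `e^(8L)`. -/
theorem sq_mul_exp_neg_le_sq {N η L : ℝ} (hη : 0 < η) (hN0 : 0 ≤ N) (hL : 1 ≤ L)
    (hN : N ≤ Real.exp L) (hηL : 1 / η ≤ Real.exp L) :
    256 * N ^ 2 * Real.exp (-(12 * L)) ≤ η ^ 2 := by
  have h1 : 1 ≤ η * Real.exp L := by rw [div_le_iff₀ hη] at hηL; linarith
  have h2 : (256 : ℝ) ≤ Real.exp L ^ 8 := by
    have : (2 : ℝ) ≤ Real.exp L := by linarith [Real.add_one_le_exp L]
    calc (256 : ℝ) = 2 ^ 8 := by norm_num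
      _ ≤ _ := by gcongr
  have h3 : Real.exp (-(12 * L)) * Real.exp L ^ 12 = 1 := by
    rw [← Real.exp_nat_mul, ← Real.exp_add]; norm_num
  have hE := Real.exp_pos L
  have hpos : 0 < Real.exp L ^ 12 := by positivity
  calc 256 * N ^ 2 * Real.exp (-(12 * L))
      ≤ Real.exp L ^ 8 * Real.exp L ^ 2 * Real.exp (-(12 * L)) := by gcongr
    _ ≤ Real.exp L ^ 8 * Real.exp L ^ 2 * Real.exp (-(12 * L)) * (η * Real.exp L) ^ 2 :=
        le_mul_of_one_le_right (by positivity) (one_le_pow₀ h1)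
    _ = η ^ 2 * (Real.exp (-(12 * L)) * Real.exp L ^ 12) := by ring
    _ = η ^ 2 := by rw [h3, mul_one]

/-- The choice of the tuple length in the Kikuchi matrix. -/
theorem exists_tuple_length {k N L η : ℝ} (hN : 1 ≤ N) (hL : 1 ≤ L) (hη : 0 < η)
    (hη1 : η ≤ 1) (hk0 : 0 ≤ k)
    (hNL : L / η ^ 2 ≤ N) (hk : 10 ^ 27 * N * L ^ 5 / η ^ 10 < k ^ 3) :
    ∃ l : ℕ, 0 < l ∧ L ≤ l ∧ l * L * (4 * 10 ^ 8) ≤ η ^ 4 * k ∧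
      147456 * L ^ 3 / η ^ 2 ≤ k * l ^ 2 / N ∧ 8 / η ^ 2 ≤ k := by
  have hN0 : 0 < N := by linarith
  have hL0 : 0 < L := by linarith
  -- Cube root of `hk`, after bounding `N` below by `L/η²`.
  have hk1 : 10 ^ 9 * L ^ 2 / η ^ 4 < k := by
    refine lt_of_pow_lt_pow_left₀ 3 hk0 (lt_of_le_of_lt ?_ hk)
    calc (10 ^ 9 * L ^ 2 / η ^ 4) ^ 3 = 10 ^ 27 * (L / η ^ 2) * L ^ 5 / η ^ 10 := by
          field_simp
      _ ≤ _ := by gcongr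
  have hkpos : 0 < k := lt_of_le_of_lt (by positivity) hk1
  -- The largest length allowed by the spectral condition. As `r ≥ 2.5 L`, rounding down leaves at
  -- least `L` and at least `r/2`; the cubic hypothesis is then exactly what makes the mean degree
  -- `k l²/N` large enough.
  set r : ℝ := η ^ 4 * k / (4 * 10 ^ 8 * L) with hr
  have hr1 : 2.5 * L ≤ r := by
    rw [hr, le_div_iff₀ (by positivity)]
    rw [div_lt_iff₀ (by positivity)] at hk1
    nlinarith
  have hr0 : 0 ≤ r := by positivity
  have hfl := Nat.floor_le hr0
  have hfl' := Nat.lt_floor_add_one r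
  have hlL : L ≤ (⌊r⌋₊ : ℝ) := by linarith
  refine ⟨⌊r⌋₊, ?_, hlL, ?_, ?_, ?_⟩
  · have : (0 : ℝ) < (⌊r⌋₊ : ℝ) := by linarith
    exact_mod_cast this
  · calc (⌊r⌋₊ : ℝ) * L * (4 * 10 ^ 8) ≤ r * L * (4 * 10 ^ 8) := by gcongr
      _ = η ^ 4 * k := by rw [hr]; field_simp
  · have h2 : r / 2 ≤ (⌊r⌋₊ : ℝ) := by linarith
    calc 147456 * L ^ 3 / η ^ 2
        ≤ (10 ^ 27 * N * L ^ 5 / η ^ 10) * (η ^ 8 / (64 * 10 ^ 16 * L ^ 2 * N)) := by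
          have : (10 ^ 27 * N * L ^ 5 / η ^ 10) * (η ^ 8 / (64 * 10 ^ 16 * L ^ 2 * N)) =
            (10 ^ 27 / (64 * 10 ^ 16)) * L ^ 3 / η ^ 2 := by field_simp
          rw [this]; gcongr; norm_num
      _ ≤ k ^ 3 * (η ^ 8 / (64 * 10 ^ 16 * L ^ 2 * N)) := by gcongr
      _ = k * (r / 2) ^ 2 / N := by rw [hr]; field_simp; norm_num
      _ ≤ _ := by gcongr
  · refine le_trans ?_ hk1.le
    rw [div_le_div_iff₀ (by positivity) (by positivity)]
    have h3 : η ^ 4 ≤ η ^ 2 := pow_le_pow_of_le_one hη.le hη1 (by norm_num)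
    have h4 : 1 ≤ L ^ 2 := one_le_pow₀ hL
    have h5 : 0 < η ^ 2 := by positivity
    nlinarith

theorem false_of_light_bound {k N L η l D₁ D S : ℝ} (hN : 1 ≤ N) (hL : 1 ≤ L) (hη : 0 < η)
    (hk : 0 < k) (hl : L ≤ l) (hl1 : l * L * (4 * 10 ^ 8) ≤ η ^ 4 * k)
    (hd : 147456 * L ^ 3 / η ^ 2 ≤ k * l ^ 2 / N) (hk8 : 8 / η ^ 2 ≤ k)
    (hD₁ : D₁ = 2 * k * l / N + 12 * L * (1024 * L / η ^ 2))
    (hD : D = 2 * (k * l) * l / N + 12 * L * D₁)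
    (he : 256 * N ^ 2 * Real.exp (-(12 * L)) ≤ η ^ 2) (hS : η * k * N / 2 ≤ S)
    (h : S ^ 2 ≤ N * (k * N + 4 * (N ^ 2 / l ^ 2 * (D * √(128 * l * L * k)) +
      4 * k * k * N ^ 3 * Real.exp (-(12 * L))))) : False := by
  have hN0 : 0 < N := by linarith
  have hl0 : 0 < l := by linarith
  set d := k * l ^ 2 / N with hddef
  have hLd : L * (k * l / N) ≤ d := by
    calc L * (k * l / N) ≤ l * (k * l / N) := by gcongr
      _ = d := by rw [hddef]; ring
  -- `27 = 2 + 24 + 1`, and `147456 = 12 · 12 · 1024` comes from `lam² τ`: the mean degree dominates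
  -- the fluctuations.
  have hDd : D ≤ 27 * d := by
    have e : D = 2 * d + 24 * (L * (k * l / N)) + 147456 * L ^ 3 / η ^ 2 := by
      rw [hD, hD₁, hddef]; ring
    linarith
  set s := √(128 * l * L * k) with hs
  have hs0 : 0 ≤ s := Real.sqrt_nonneg _
  have hs2 : s ^ 2 = 128 * l * L * k := Real.sq_sqrt (by positivity)
  have hA : N ^ 2 / l ^ 2 * (D * s) ≤ 27 * k * N * s := by
    calc N ^ 2 / l ^ 2 * (D * s) ≤ N ^ 2 / l ^ 2 * (27 * d * s) := by gcongr
      _ = 27 * k * N * s := by rw [hddef]; field_simp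
  have hB : 4 * k * k * N ^ 3 * Real.exp (-(12 * L)) ≤ k ^ 2 * N * η ^ 2 / 64 := by
    have : 0 ≤ k ^ 2 * N / 64 := by positivity
    calc 4 * k * k * N ^ 3 * Real.exp (-(12 * L)) =
          k ^ 2 * N / 64 * (256 * N ^ 2 * Real.exp (-(12 * L))) := by ring
      _ ≤ k ^ 2 * N / 64 * η ^ 2 := by gcongr
      _ = _ := by ring
  have hS2 : (η * k * N / 2) ^ 2 ≤ S ^ 2 := by gcongr
  have h1 : η ^ 2 * k ^ 2 * N / 4 ≤ k * N + 4 * (27 * k * N * s + k ^ 2 * N * η ^ 2 / 64) := by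
    have h2 : N * (η ^ 2 * k ^ 2 * N / 4) ≤
        N * (k * N + 4 * (27 * k * N * s + k ^ 2 * N * η ^ 2 / 64)) := by
      calc N * (η ^ 2 * k ^ 2 * N / 4) = (η * k * N / 2) ^ 2 := by ring
        _ ≤ _ := hS2.trans h
        _ ≤ _ := by gcongr
    exact le_of_mul_le_mul_left h2 hN0
  have hk8' : 8 ≤ k * η ^ 2 := by rwa [div_le_iff₀ (by positivity)] at hk8
  -- Of the quarter on the left of `h1`, the diagonal takes at most an eighth and the atypical
  -- tuples a sixteenth; `1728 = 16 · 4 · 27`. Squaring gives `1728² · 128 = 382205952 < 4 · 10^8`,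
  -- against `hl1`.
  have h3 : η ^ 2 * k ≤ 1728 * s := by
    have hkN : 0 < k * N := by positivity
    have : k * N * (η ^ 2 * k) ≤ k * N * (1728 * s) := by nlinarith
    exact le_of_mul_le_mul_left this hkN
  have h4 : (η ^ 2 * k) ^ 2 ≤ (1728 * s) ^ 2 := by gcongr
  rw [mul_pow 1728, hs2] at h4
  have h5 : η ^ 4 * k ≤ 382205952 * (l * L) := by
    have : k * (η ^ 4 * k) ≤ k * (382205952 * (l * L)) := by nlinarith
    exact le_of_mul_le_mul_left this hk
  have h6 : 0 < l * L := by positivity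
  nlinarith

theorem card_pow_three_le_of_signedForm {ι : Type*} {V : Type u} [Fintype ι] [DecidableEq ι]
    [Fintype V] [Nonempty V] {T : ι → V → V → V → ℝ} (hT : SliceBounded T) {L η : ℝ}
    (hL : 1 ≤ L) (hη : 0 < η) (hη1 : η ≤ 1) (hN : (Fintype.card V : ℝ) ≤ Real.exp L)
    (hηL : 1 / η ≤ Real.exp L) (x y z : (ι → Bool) → V → ℝ)
    (hx : ∀ b v, |x b v| ≤ 1) (hy : ∀ b v, |y b v| ≤ 1) (hz : ∀ b v, |z b v| ≤ 1)
    (h : η * Fintype.card ι * Fintype.card V ≤ 𝔼 b, signedForm T b (x b) (y b) (z b)) :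
    (Fintype.card ι : ℝ) ^ 3 ≤ 10 ^ 27 * Fintype.card V * L ^ 5 / η ^ 10 := by
  classical
  choose x' y' z' hx' hy' hz' hle using fun b =>
    exists_sign_signedForm_ge T b (x b) (y b) (z b) (hx b) (hy b) (hz b)
  replace h := h.trans (Finset.expect_le_expect fun b _ => hle b)
  have habs : ∀ a : ℝ, a * a = 1 → |a| ≤ 1 := by
    intro a ha; rcases mul_self_eq_one_iff.mp ha with h | h <;> simp [h]
  have ax : ∀ b v, |x' b v| ≤ 1 := fun b v => habs _ (hx' b v)
  have ay : ∀ b v, |y' b v| ≤ 1 := fun b v => habs _ (hy' b v)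
  have az : ∀ b v, |z' b v| ≤ 1 := fun b v => habs _ (hz' b v)
  have hN1 : (1 : ℝ) ≤ Fintype.card V := by exact_mod_cast Fintype.card_pos (α := V)
  have hk0 : (0 : ℝ) ≤ Fintype.card ι := Nat.cast_nonneg _
  by_contra hcon
  push Not at hcon
  -- For small `N` flattening with all pairs suffices: it gives `k ≤ 64 (L/η²) N`, and the surplus
  -- `N²` in the cube is at most `(L/η²)²`.
  by_cases hNL : (Fintype.card V : ℝ) < L / η ^ 2
  · have h1 := h.trans (expect_signedForm_le_of_support hT Finset.univ (by simp) hL hN x' y' z'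
      ax ay az)
    rw [Finset.card_univ, Fintype.card_prod, Nat.cast_mul] at h1
    set k : ℝ := (Fintype.card ι : ℝ)
    set N : ℝ := (Fintype.card V : ℝ)
    have hkpos : 0 < k := by
      by_contra hk
      have hk0' : k = 0 := le_antisymm (not_lt.mp hk) hk0
      rw [hk0'] at hcon
      have : 0 ≤ 10 ^ 27 * N * L ^ 5 / η ^ 10 := by positivity
      norm_num at hcon
      linarith
    have h2 : (η * k * N) ^ 2 ≤ 64 * L * k * (N * N) * N := by
      rw [← Real.sq_sqrt (show 0 ≤ 64 * L * k * (N * N) * N by positivity)]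
      gcongr
    have h3 : k ≤ 64 * (L / η ^ 2) * N := by
      have hpos : 0 < k * N ^ 2 := by positivity
      have : k * N ^ 2 * (k * η ^ 2) ≤ k * N ^ 2 * (64 * L * N) := by nlinarith
      have := le_of_mul_le_mul_left this hpos
      rw [show 64 * (L / η ^ 2) * N = 64 * L * N / η ^ 2 by ring, le_div_iff₀ (by positivity)]
      exact this
    refine absurd hcon (not_lt.mpr ?_)
    calc k ^ 3 ≤ (64 * (L / η ^ 2) * N) ^ 3 := by gcongr
      _ = 64 ^ 3 * (L / η ^ 2) ^ 3 * N * N ^ 2 := by ring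
      _ ≤ 64 ^ 3 * (L / η ^ 2) ^ 3 * N * (L / η ^ 2) ^ 2 := by gcongr
      _ = 64 ^ 3 * N * L ^ 5 / η ^ 10 := by field_simp
      _ ≤ _ := by gcongr; norm_num
  · push Not at hNL
    obtain ⟨l, hl0, hlL, hl1, hd, hk8⟩ := exists_tuple_length hN1 hL hη hη1 hk0 hNL hcon
    set τ : ℝ := 1024 * L / η ^ 2 with hτdef
    have hτ : 0 < τ := by positivity
    let P : V → V → Prop := fun u v => τ < ∑ i, ∑ w, |T i u v w|
    let P' : V → V → Prop := fun u w => τ < ∑ i, ∑ v, |T i u v w|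
    -- `T₁` carries the heavy pairs `(u,v)`, `T₂` the remaining heavy pairs `(u,w)`. Each
    -- contributes at most a quarter of the correlation, leaving half of it for the light tensor
    -- `T₃`.
    let T₁ : ι → V → V → V → ℝ := fun i u v w => if P u v then T i u v w else 0
    let T₂ : ι → V → V → V → ℝ := fun i u v w => if P u v then 0 else
      if P' u w then T i u v w else 0
    let T₃ : ι → V → V → V → ℝ := fun i u v w => if P u v then 0 else
      if P' u w then 0 else T i u v w
    have hsum : ∀ b x y z, signedForm T b x y z =
        signedForm T₁ b x y z + (signedForm T₂ b x y z + signedForm T₃ b x y z) := by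
      intro b x y z
      rw [← signedForm_add, ← signedForm_add]
      congr 1
      funext i u v w
      simp only [T₁, T₂, T₃]; split_ifs <;> simp
    have m₁ : SliceBounded T₁ := hT.mono fun i u v w => by
      simp only [T₁]; split_ifs <;> simp
    have m₂ : SliceBounded T₂ := hT.mono fun i u v w => by
      simp only [T₂]; split_ifs <;> simp
    have m₃ : SliceBounded T₃ := hT.mono fun i u v w => by
      simp only [T₃]; split_ifs <;> simp
    have h₁ := expect_signedForm_le_of_heavy hT m₁ hL hη hN
      (fun u v huv i w => if_neg (not_lt.mpr huv)) x' y' z' ax ay az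
    have h₂ := expect_signedForm_le_of_heavy hT.swap m₂.swap hL hη hN
      (fun u w huw i v => by
        have : ¬ P' u w := not_lt.mpr huw
        simp [T₂, this]) x' z' y' ax az ay
    simp_rw [signedForm_swap] at h₂
    have h12 : ∀ u v, ∑ i, ∑ w, |T₃ i u v w| ≤ τ := by
      intro u v
      by_cases huv : P u v
      · simp [T₃, huv, hτ.le]
      · refine le_trans (Finset.sum_le_sum fun i _ => Finset.sum_le_sum fun w _ => ?_)
          (not_lt.mp huv)
        simp only [T₃]; split_ifs <;> simp
    have h13 : ∀ u w, ∑ i, ∑ v, |T₃ i u v w| ≤ τ := by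
      intro u w
      by_cases huw : P' u w
      · simp [T₃, huw, hτ.le]
      · refine le_trans (Finset.sum_le_sum fun i _ => Finset.sum_le_sum fun v _ => ?_)
          (not_lt.mp huw)
        simp only [T₃]; split_ifs <;> simp
    have h₃ := expect_signedForm_sq_le_of_light m₃ hl0 hτ h12 h13 (lam := 12 * L) (by positivity)
      hL hN rfl rfl x' y' z' hx' hy' hz'
    simp_rw [hsum, Finset.expect_add_distrib] at h
    have hkpos : (0 : ℝ) < Fintype.card ι := lt_of_lt_of_le (by positivity) hk8
    exact false_of_light_bound hN1 hL hη hkpos hlL hl1 hd hk8 rfl rfl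
      (sq_mul_exp_neg_le_sq hη (by positivity) hL hN hηL)
      (by linarith) h₃

/-! ### Flat form of three-query decoders. -/

/-- A decoding procedure with at most three queries in flat form; the queries are optional. -/
abbrev FlatTree (A : Type u) (n : ℕ) : Type u :=
  Option (Fin n) × (A → Option (Fin n)) × (A → A → Option (Fin n)) × (A → A → A → Bool)

/-- The answer to an optional query, with a default symbol. -/
def optAnswer {A : Type u} {n : ℕ} (a₀ : A) (y : Fin n → A) (o : Option (Fin n)) : A :=
  o.elim a₀ y

/-- The output of a flat procedure. -/
def FlatTree.eval {A : Type u} {n : ℕ} (a₀ : A) (y : Fin n → A) (f : FlatTree A n) : Bool :=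
  f.2.2.2 (optAnswer a₀ y f.1) (optAnswer a₀ y (f.2.1 (optAnswer a₀ y f.1)))
    (optAnswer a₀ y (f.2.2.1 (optAnswer a₀ y f.1)
      (optAnswer a₀ y (f.2.1 (optAnswer a₀ y f.1)))))

theorem QueryTree.exists_flat_zero {A : Type u} {n : ℕ} (t : QueryTree A n 0) :
    ∃ o : Bool, ∀ y, t.run y = o := by
  cases t with
  | output bit => exact ⟨bit, fun y => by simp [QueryTree.run]⟩

theorem QueryTree.exists_flat_one {A : Type u} {n : ℕ} (a₀ : A) (t : QueryTree A n 1) :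
    ∃ (v : Option (Fin n)) (o : A → Bool), ∀ y, t.run y = o (optAnswer a₀ y v) := by
  cases t with
  | output bit => exact ⟨none, fun _ => bit, fun y => by simp [QueryTree.run]⟩
  | query v next =>
    choose o ho using fun a => (next a).exists_flat_zero
    exact ⟨some v, o, fun y => by simp [QueryTree.run, ho, optAnswer]⟩

theorem QueryTree.exists_flat_two {A : Type u} {n : ℕ} (a₀ : A) (t : QueryTree A n 2) :
    ∃ (v : Option (Fin n)) (w : A → Option (Fin n)) (o : A → A → Bool),
      ∀ y, t.run y = o (optAnswer a₀ y v) (optAnswer a₀ y (w (optAnswer a₀ y v))) := by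
  cases t with
  | output bit => exact ⟨none, fun _ => none, fun _ _ => bit, fun y => by simp [QueryTree.run]⟩
  | query v next =>
    choose w o ho using fun a => (next a).exists_flat_one a₀
    exact ⟨some v, w, o, fun y => by simp [QueryTree.run, ho, optAnswer]⟩

theorem QueryTree.exists_flat {A : Type u} {n : ℕ} (a₀ : A) (t : QueryTree A n 3) :
    ∃ f : FlatTree A n, ∀ y, t.run y = f.eval a₀ y := by
  cases t with
  | output bit =>
    exact ⟨(none, fun _ => none, fun _ _ => none, fun _ _ _ => bit),
      fun y => by simp [QueryTree.run, FlatTree.eval]⟩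
  | query v next =>
    choose w₁ w₂ o ho using fun a => (next a).exists_flat_two a₀
    exact ⟨(some v, w₁, w₂, o), fun y => by
      simp [QueryTree.run, ho, FlatTree.eval, optAnswer]⟩

/-- Pushing the law of the decoder to flat procedures, a finite type, turns its output probabilities
into finite sums with weights independent of the oracle. -/
theorem exists_flat_decoder {A : Type u} [Fintype A] [DecidableEq A] {n : ℕ} (a₀ : A)
    (dec : PMF (QueryTree A n 3)) :
    ∃ p : FlatTree A n → ℝ, (∀ f, 0 ≤ p f) ∧ ∑ f, p f = 1 ∧ ∀ y β,
      (outputLaw dec y β).toReal = ∑ f, p f * (if f.eval a₀ y = β then 1 else 0) := by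
  choose flat hflat using fun t : QueryTree A n 3 => t.exists_flat a₀
  refine ⟨fun f => (dec.map flat f).toReal, fun f => ENNReal.toReal_nonneg, ?_, ?_⟩
  · have h1 : ∑ f, dec.map flat f = 1 := by rw [← PMF.tsum_coe (dec.map flat), tsum_fintype]
    rw [← ENNReal.toReal_sum fun f _ => PMF.apply_ne_top _ f, h1, ENNReal.toReal_one]
  · intro y β
    have h1 : outputLaw dec y = (dec.map flat).map (FlatTree.eval a₀ y) := by
      rw [outputLaw, PMF.map_comp]
      congr 1
      funext t
      exact hflat t y
    rw [h1, PMF.map_apply, tsum_fintype, ENNReal.toReal_sum]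
    · refine Finset.sum_congr rfl fun f _ => ?_
      by_cases h : f.eval a₀ y = β
      · rw [if_pos h, if_pos h.symm, mul_one]
      · rw [if_neg h, if_neg (fun h' => h h'.symm), mul_zero, ENNReal.toReal_zero]
    · intro f _
      split_ifs
      · exact PMF.apply_ne_top _ f
      · exact ENNReal.zero_ne_top

/-! ### From a decoder to a tensor with bounded slices. -/

/-- The indicator that the symbol read by an optional query is `a`, as a combination of the
coordinates of `answerVector`. -/
noncomputable def answerKernel {A : Type u} [DecidableEq A] {n : ℕ} (a₀ : A) (o : Option (Fin n))
    (a : A) (ξ : Fin n × Option A) : ℝ :=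
  match o with
  -- An absent query spreads its unit weight over all `n` dummy coordinates, so no dummy slice
  -- becomes large.
  | none => if a = a₀ ∧ ξ.2 = none then 1 / n else 0
  | some v => if ξ = (v, some a) then 1 else 0

/-- The indicators of the symbols of a word, with dummy coordinates equal to one. -/
noncomputable def answerVector {A : Type u} [DecidableEq A] {n : ℕ} (y : Fin n → A)
    (ξ : Fin n × Option A) : ℝ :=
  match ξ.2 with
  | none => 1
  | some a => if y ξ.1 = a then 1 else 0

theorem abs_answerVector_le {A : Type u} [DecidableEq A] {n : ℕ} (y : Fin n → A)
    (ξ : Fin n × Option A) : |answerVector y ξ| ≤ 1 := by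
  rcases ξ with ⟨v, _ | a⟩
  · simp [answerVector]
  · simp only [answerVector]; split_ifs <;> simp

theorem answerKernel_nonneg {A : Type u} [DecidableEq A] {n : ℕ} (a₀ : A) (o : Option (Fin n))
    (a : A) (ξ : Fin n × Option A) : 0 ≤ answerKernel a₀ o a ξ := by
  rcases o with _ | v <;> simp only [answerKernel] <;> split_ifs <;> positivity

theorem sum_answerKernel_mul_answerVector {A : Type u} [Fintype A] [DecidableEq A] {n : ℕ}
    (hn : 0 < n) (a₀ : A) (y : Fin n → A) (o : Option (Fin n)) (a : A) :
    ∑ ξ, answerKernel a₀ o a ξ * answerVector y ξ = if optAnswer a₀ y o = a then 1 else 0 := by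
  rcases o with _ | v
  · have hn' : (n : ℝ) ≠ 0 := by exact_mod_cast hn.ne'
    rw [Fintype.sum_prod_type]
    simp only [Fintype.sum_option, answerKernel, answerVector, optAnswer, Option.elim,
      reduceCtorEq, and_false, if_false, zero_mul, Finset.sum_const_zero, add_zero, and_true,
      mul_one, eq_comm (a := a)]
    by_cases h : a₀ = a
    · simp [h, hn']
    · simp [h]
  · by_cases h : y v = a <;> simp [answerKernel, answerVector, optAnswer, h]

theorem sum_answerKernel_le {A : Type u} [Fintype A] [DecidableEq A] {n : ℕ}
    (hn : 0 < n) (a₀ : A) (o : Option (Fin n)) (a : A) :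
    ∑ ξ, answerKernel a₀ o a ξ ≤ 1 := by
  rcases o with _ | v
  · have hn' : (n : ℝ) ≠ 0 := by exact_mod_cast hn.ne'
    rw [Fintype.sum_prod_type]
    simp only [Fintype.sum_option, answerKernel,
      reduceCtorEq, and_false, if_false, Finset.sum_const_zero, add_zero, and_true]
    by_cases h : a = a₀
    · simp [h, hn']
    · simp [h]
  · simp [answerKernel]

/-- The majorant does not depend on the guessed symbol `a`, so slices can be bounded by the query
frequencies alone. -/
theorem answerKernel_filter_le {A : Type u} [DecidableEq A] {n : ℕ} (a₀ : A)
    (B : Finset (Fin n)) (o : Option (Fin n)) (a : A) (ξ : Fin n × Option A) :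
    answerKernel a₀ (o.filter fun v => v ∉ B) a ξ ≤
      if ξ.2 = none then 1 / (n : ℝ) else if ξ.1 ∈ B then 0 else if o = some ξ.1 then 1 else 0 := by
  have hn : (0 : ℝ) ≤ 1 / n := by positivity
  rcases ξ with ⟨v, _ | a'⟩
  · rcases o.filter (fun v => v ∉ B) with _ | w
    · simp only [answerKernel]; split_ifs <;> simp_all
    · simp [answerKernel]
  · rcases o with _ | w
    · simp [answerKernel]
    · by_cases hw : w ∈ B
      · simp [Option.filter, hw, answerKernel]
        split_ifs <;> simp
      · simp only [Option.filter, hw, answerKernel]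
        by_cases hvw : v = w
        · subst hvw; simp [hw]; split_ifs <;> simp
        · have : ¬ w = v := fun h => hvw h.symm
          simp [hvw]
          split_ifs <;> simp

theorem sum_mul_sum_mul_sum_kernel {Ω V : Type*} [Fintype Ω] [Fintype V] (W : Ω → ℝ)
    (κ₁ κ₂ κ₃ : Ω → V → ℝ) (x : V → ℝ) :
    ∑ u, ∑ v, ∑ w, (∑ ω, W ω * (κ₁ ω u * κ₂ ω v * κ₃ ω w)) * (x u * x v * x w) =
      ∑ ω, W ω * ((∑ u, κ₁ ω u * x u) * (∑ v, κ₂ ω v * x v) * ∑ w, κ₃ ω w * x w) := by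
  have h : ∀ ω, W ω * ((∑ u, κ₁ ω u * x u) * (∑ v, κ₂ ω v * x v) * ∑ w, κ₃ ω w * x w) =
      ∑ u, ∑ v, ∑ w, W ω * (κ₁ ω u * κ₂ ω v * κ₃ ω w) * (x u * x v * x w) := by
    intro ω
    rw [Finset.sum_mul_sum, Finset.sum_mul, Finset.mul_sum]
    refine Finset.sum_congr rfl fun u _ => ?_
    rw [Finset.sum_mul, Finset.mul_sum]
    refine Finset.sum_congr rfl fun v _ => ?_
    rw [Finset.mul_sum, Finset.mul_sum]
    exact Finset.sum_congr rfl fun w _ => by ring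
  simp_rw [h, Finset.sum_mul]
  conv_rhs => rw [Finset.sum_comm]
  refine Finset.sum_congr rfl fun u _ => ?_
  conv_rhs => rw [Finset.sum_comm]
  refine Finset.sum_congr rfl fun v _ => ?_
  conv_rhs => rw [Finset.sum_comm]

theorem sum_sum_abs_kernel_le {Ω V : Type*} [Fintype Ω] [Fintype V] (W : Ω → ℝ)
    {κ₁ κ₂ κ₃ : Ω → V → ℝ} (h₁ : ∀ ω u, 0 ≤ κ₁ ω u) (h₂ : ∀ ω u, 0 ≤ κ₂ ω u)
    (h₃ : ∀ ω u, 0 ≤ κ₃ ω u) (s₂ : ∀ ω, ∑ u, κ₂ ω u ≤ 1) (s₃ : ∀ ω, ∑ u, κ₃ ω u ≤ 1) (u : V) :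
    ∑ v, ∑ w, |∑ ω, W ω * (κ₁ ω u * κ₂ ω v * κ₃ ω w)| ≤ ∑ ω, |W ω| * κ₁ ω u := by
  calc ∑ v, ∑ w, |∑ ω, W ω * (κ₁ ω u * κ₂ ω v * κ₃ ω w)|
      ≤ ∑ v, ∑ w, ∑ ω, |W ω| * κ₁ ω u * (κ₂ ω v * κ₃ ω w) := by
        refine Finset.sum_le_sum fun v _ => Finset.sum_le_sum fun w _ => ?_
        refine (Finset.abs_sum_le_sum_abs _ _).trans (le_of_eq ?_)
        refine Finset.sum_congr rfl fun ω _ => ?_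
        rw [abs_mul, abs_of_nonneg (mul_nonneg (mul_nonneg (h₁ _ _) (h₂ _ _)) (h₃ _ _))]
        ring
    _ = ∑ ω, |W ω| * κ₁ ω u * ((∑ v, κ₂ ω v) * ∑ w, κ₃ ω w) := by
        simp_rw [Finset.sum_mul_sum, Finset.mul_sum]
        conv_rhs => rw [Finset.sum_comm]
        refine Finset.sum_congr rfl fun v _ => ?_
        conv_rhs => rw [Finset.sum_comm]
    _ ≤ _ := Finset.sum_le_sum fun ω _ =>
        mul_le_of_le_one_right (mul_nonneg (abs_nonneg _) (h₁ _ _))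
          (mul_le_one₀ (s₂ ω) (Finset.sum_nonneg fun w _ => h₃ ω w) (s₃ ω))

/-- Only the guess equal to the true answers survives, and the positions depend on the guess alone:
adaptivity is traded for a sum over `|A|^3` terms. -/
theorem sum_guess_eq {A : Type u} [Fintype A] [DecidableEq A] {n : ℕ} (a₀ : A) (y : Fin n → A)
    (f : FlatTree A n) :
    ∑ a : A × A × A, boolSign (f.2.2.2 a.1 a.2.1 a.2.2) *
      ((if optAnswer a₀ y f.1 = a.1 then 1 else 0) *
        (if optAnswer a₀ y (f.2.1 a.1) = a.2.1 then 1 else 0) *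
          if optAnswer a₀ y (f.2.2.1 a.1 a.2.1) = a.2.2 then 1 else 0) =
      boolSign (f.eval a₀ y) := by
  rw [Fintype.sum_prod_type, Finset.sum_eq_single (optAnswer a₀ y f.1)]
  · rw [Fintype.sum_prod_type,
      Finset.sum_eq_single (optAnswer a₀ y (f.2.1 (optAnswer a₀ y f.1)))]
    · rw [Finset.sum_eq_single (optAnswer a₀ y (f.2.2.1 (optAnswer a₀ y f.1)
        (optAnswer a₀ y (f.2.1 (optAnswer a₀ y f.1)))))]
      · simp [FlatTree.eval]
      · intro a _ ha; simp [ha.symm]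
      · simp
    · intro a _ ha; simp [ha.symm]
    · simp
  · intro a _ ha; simp [ha.symm]
  · simp

/-- The coordinates that are queried with atypically large probability under random answers are
few; the remaining queries define a tensor with bounded slices computing the decoder. -/
theorem exists_tensor_of_decoder {A : Type u} [Fintype A] [DecidableEq A] {n : ℕ} (hn : 0 < n)
    (a₀ : A) {δ : ℝ} (hδ : 0 < δ) (hδ1 : δ ≤ 1) {p : FlatTree A n → ℝ} (hp : ∀ f, 0 ≤ p f)
    (hp1 : ∑ f, p f = 1) :
    ∃ (B : Finset (Fin n))
      (T : (Fin n × Option A) → (Fin n × Option A) → (Fin n × Option A) → ℝ),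
      (#B : ℝ) ≤ δ * n ∧ (∀ u, ∑ v, ∑ w, |T u v w| ≤ 1) ∧ (∀ v, ∑ u, ∑ w, |T u v w| ≤ 1) ∧
      (∀ w, ∑ u, ∑ v, |T u v w| ≤ 1) ∧ ∀ y : Fin n → A,
        ∑ u, ∑ v, ∑ w, T u v w * (answerVector y u * answerVector y v * answerVector y w) =
          δ * n / (3 * (Fintype.card A : ℝ) ^ 3) *
            ∑ f, p f * boolSign (f.eval a₀ fun v => if v ∈ B then a₀ else y v) := by
  have hn0 : (0 : ℝ) < n := by exact_mod_cast hn
  have hA : (0 : ℝ) < Fintype.card A := by exact_mod_cast Fintype.card_pos_iff.mpr ⟨a₀⟩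
  set m : ℝ := (Fintype.card A : ℝ) with hm
  set c : ℝ := δ * n / (3 * m ^ 3) with hc
  have hc0 : 0 < c := by positivity
  let Ω := FlatTree A n × A × A × A
  let o₁ : Ω → Option (Fin n) := fun ω => ω.1.1
  let o₂ : Ω → Option (Fin n) := fun ω => ω.1.2.1 ω.2.1
  let o₃ : Ω → Option (Fin n) := fun ω => ω.1.2.2.1 ω.2.1 ω.2.2.1
  let hit : (Ω → Option (Fin n)) → Fin n → ℝ := fun o v =>
    ∑ ω, p ω.1 * if o ω = some v then 1 else 0
  have hhit0 : ∀ o v, 0 ≤ hit o v := fun o v =>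
    Finset.sum_nonneg fun ω _ => mul_nonneg (hp _) (by split_ifs <;> norm_num)
  have hPsum : ∑ ω : Ω, p ω.1 = m ^ 3 := by
    rw [Fintype.sum_prod_type]
    simp only [Finset.sum_const, Finset.card_univ, Fintype.card_prod, nsmul_eq_mul,
      ← Finset.mul_sum, hp1]
    push_cast; ring
  have hhit : ∀ o, ∑ v, hit o v ≤ m ^ 3 := by
    intro o
    rw [Finset.sum_comm, ← hPsum]
    refine Finset.sum_le_sum fun ω _ => ?_
    rw [← Finset.mul_sum]
    refine mul_le_of_le_one_right (hp _) ?_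
    rcases o ω with _ | v <;> simp
  -- The total query weight over all guesses is at most `3 m^3`, so this threshold gives `#B ≤ 3 m^3
  -- c = δ n`; outside `B`, scaling by `c` makes slices at most 1.
  let B : Finset (Fin n) := {v | 1 / c < hit o₁ v + hit o₂ v + hit o₃ v}
  have hBle : ∀ v, v ∉ B → hit o₁ v + hit o₂ v + hit o₃ v ≤ 1 / c := by
    intro v hv; simpa [B] using hv
  have hB : (#B : ℝ) ≤ δ * n := by
    have h1 : (#B : ℝ) * (1 / c) ≤ 3 * m ^ 3 := by
      rw [← nsmul_eq_mul]
      calc #B • (1 / c) ≤ ∑ v ∈ B, (hit o₁ v + hit o₂ v + hit o₃ v) :=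
            Finset.card_nsmul_le_sum _ _ _ fun v hv => ((Finset.mem_filter.mp hv).2).le
        _ ≤ ∑ v, (hit o₁ v + hit o₂ v + hit o₃ v) :=
            Finset.sum_le_sum_of_subset_of_nonneg (Finset.subset_univ B) fun v _ _ =>
              add_nonneg (add_nonneg (hhit0 _ _) (hhit0 _ _)) (hhit0 _ _)
        _ = ∑ v, hit o₁ v + ∑ v, hit o₂ v + ∑ v, hit o₃ v := by
            rw [Finset.sum_add_distrib, Finset.sum_add_distrib]
        _ ≤ _ := by linarith [hhit o₁, hhit o₂, hhit o₃]
    rw [mul_one_div, div_le_iff₀ hc0, hc] at h1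
    refine h1.trans (le_of_eq ?_)
    field_simp
  let κ : (Ω → Option (Fin n)) → (Ω → A) → Ω → (Fin n × Option A) → ℝ := fun o a ω ξ =>
    answerKernel a₀ ((o ω).filter fun v => v ∉ B) (a ω) ξ
  let W : Ω → ℝ := fun ω => c * p ω.1 * boolSign (ω.1.2.2.2 ω.2.1 ω.2.2.1 ω.2.2.2)
  have hW : ∀ ω, |W ω| = c * p ω.1 := by
    intro ω
    simp only [W]
    rw [abs_mul, abs_boolSign, mul_one, abs_of_nonneg (mul_nonneg hc0.le (hp _))]
  have hκ0 : ∀ o a ω ξ, 0 ≤ κ o a ω ξ := fun o a ω ξ => answerKernel_nonneg _ _ _ _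
  have hκ1 : ∀ o a ω, ∑ ξ, κ o a ω ξ ≤ 1 := fun o a ω => sum_answerKernel_le hn _ _ _
  have hslice : ∀ o a, (∀ v, v ∉ B → hit o v ≤ 1 / c) → ∀ ξ, ∑ ω, |W ω| * κ o a ω ξ ≤ 1 := by
    intro o a ho ξ
    calc ∑ ω, |W ω| * κ o a ω ξ ≤ ∑ ω : Ω, c * p ω.1 * (if ξ.2 = none then 1 / (n : ℝ) else
          if ξ.1 ∈ B then 0 else if o ω = some ξ.1 then 1 else 0) := by
          refine Finset.sum_le_sum fun ω _ => ?_
          rw [hW]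
          exact mul_le_mul_of_nonneg_left (answerKernel_filter_le _ _ _ _ _)
            (mul_nonneg hc0.le (hp _))
      _ ≤ 1 := by
          by_cases h1 : ξ.2 = none
          · simp only [h1, if_true]
            rw [← Finset.sum_mul, ← Finset.mul_sum, hPsum, hc]
            rw [show δ * n / (3 * m ^ 3) * m ^ 3 * (1 / n) = δ / 3 by field_simp]
            linarith
          · by_cases h2 : ξ.1 ∈ B
            · simp [h1, h2]
            · simp only [h1, h2, if_false, mul_assoc]
              rw [← Finset.mul_sum]
              have := ho _ h2
              rw [le_div_iff₀ hc0, mul_comm] at this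
              exact this
  let a₁ : Ω → A := fun ω => ω.2.1
  let a₂ : Ω → A := fun ω => ω.2.2.1
  let a₃ : Ω → A := fun ω => ω.2.2.2
  have e₁ := hslice o₁ a₁ fun v hv => by linarith [hBle v hv, hhit0 o₂ v, hhit0 o₃ v]
  have e₂ := hslice o₂ a₂ fun v hv => by linarith [hBle v hv, hhit0 o₁ v, hhit0 o₃ v]
  have e₃ := hslice o₃ a₃ fun v hv => by linarith [hBle v hv, hhit0 o₁ v, hhit0 o₂ v]
  refine ⟨B, fun u v w => ∑ ω, W ω * (κ o₁ a₁ ω u * κ o₂ a₂ ω v * κ o₃ a₃ ω w), hB, ?_, ?_, ?_, ?_⟩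
  · intro u
    exact (sum_sum_abs_kernel_le W (hκ0 _ _) (hκ0 _ _) (hκ0 _ _) (hκ1 _ _) (hκ1 _ _) u).trans (e₁ u)
  · intro v
    refine le_trans (le_of_eq ?_) ((sum_sum_abs_kernel_le W (hκ0 o₂ a₂) (hκ0 o₁ a₁) (hκ0 o₃ a₃)
      (hκ1 _ _) (hκ1 _ _) v).trans (e₂ v))
    simp_rw [mul_comm (κ o₂ a₂ _ _)]
  · intro w
    refine le_trans (le_of_eq ?_) ((sum_sum_abs_kernel_le W (hκ0 o₃ a₃) (hκ0 o₁ a₁) (hκ0 o₂ a₂)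
      (hκ1 _ _) (hκ1 _ _) w).trans (e₃ w))
    refine Finset.sum_congr rfl fun u _ => Finset.sum_congr rfl fun v _ => ?_
    congr 1
    exact Finset.sum_congr rfl fun ω _ => by ring
  · intro y
    rw [sum_mul_sum_mul_sum_kernel]
    -- Dropping a query in `B` amounts to reading the default symbol there, that is, to querying the
    -- corrupted word.
    have hans : ∀ o : Option (Fin n), optAnswer a₀ y (o.filter fun v => v ∉ B) =
        optAnswer a₀ (fun v => if v ∈ B then a₀ else y v) o := by
      rintro (_ | v)
      · rfl
      · by_cases hv : v ∈ B <;> simp [Option.filter, optAnswer, hv]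
    simp only [κ, sum_answerKernel_mul_answerVector hn, hans]
    rw [Fintype.sum_prod_type, Finset.mul_sum]
    refine Finset.sum_congr rfl fun f _ => ?_
    rw [← sum_guess_eq a₀ (fun v => if v ∈ B then a₀ else y v) f, Finset.mul_sum, Finset.mul_sum]
    refine Finset.sum_congr rfl fun a _ => ?_
    simp only [W, o₁, o₂, o₃, a₁, a₂, a₃]
    ring

/-! ### Bounds for locally decodable codes. -/

theorem outputLaw_le_one {A : Type u} {n q : ℕ} (dec : PMF (QueryTree A n q)) (y : Fin n → A)
    (β : Bool) : (outputLaw dec y β).toReal ≤ 1 :=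
  ENNReal.toReal_le_of_le_ofReal zero_le_one (by simpa using PMF.coe_le_one _ _)

theorem outputLaw_add {A : Type u} {n q : ℕ} (dec : PMF (QueryTree A n q)) (y : Fin n → A) :
    (outputLaw dec y true).toReal + (outputLaw dec y false).toReal = 1 := by
  rw [← ENNReal.toReal_add (PMF.apply_ne_top _ _) (PMF.apply_ne_top _ _)]
  have h := (outputLaw dec y).tsum_coe
  rw [tsum_fintype, Fintype.sum_bool] at h
  rw [h, ENNReal.toReal_one]

/-- No word is close to the codewords of two messages. -/
theorem IsLDC.eq_of_close {A : Type u} [DecidableEq A] {k n q : ℕ} {δ ε : ℝ} (hε : 0 < ε)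
    {C : (Fin k → Bool) → (Fin n → A)} (hC : IsLDC q δ ε C) {b b' : Fin k → Bool} {y : Fin n → A}
    (h : (hammingDist y (C b) : ℝ) ≤ δ * n) (h' : (hammingDist y (C b') : ℝ) ≤ δ * n) :
    b = b' := by
  obtain ⟨dec, hdec⟩ := hC
  funext i
  by_contra hne
  have h1 := hdec b i y h
  have h2 := hdec b' i y h'
  have h3 := outputLaw_add (dec i) y
  cases hb : b i <;> cases hb' : b' i <;> simp_all <;> linarith

/-- In each degenerate case for `δ`, the alphabet or `n`, a single word would be close to the
codewords of two messages. The bound on `ε` holds because probabilities are at most one. -/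
theorem IsLDC.parameters {A : Type u} [Fintype A] [DecidableEq A] {k n q : ℕ} {δ ε : ℝ}
    (hk : 0 < k) (hδ : 0 < δ) (hε : 0 < ε) {C : (Fin k → Bool) → (Fin n → A)}
    (hC : IsLDC q δ ε C) : δ ≤ 1 ∧ ε ≤ 1 ∧ 2 ≤ Fintype.card A ∧ 0 < n := by
  let b : Fin k → Bool := fun _ => true
  let b' : Fin k → Bool := fun _ => false
  have hbb' : b ≠ b' := fun h => by simpa [b, b'] using congrFun h ⟨0, hk⟩
  have hdist : ∀ b : Fin k → Bool, (hammingDist (C b) (C b) : ℝ) ≤ δ * n := by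
    intro b; rw [hammingDist_self]; simp; positivity
  have hsub : ¬ Subsingleton (Fin n → A) := fun hs =>
    hbb' (hC.eq_of_close hε (hdist b) (by rw [Subsingleton.elim (C b') (C b)]; exact hdist b))
  refine ⟨?_, ?_, ?_, ?_⟩
  · by_contra hδ1
    push Not at hδ1
    refine hbb' (hC.eq_of_close hε (hdist b) (le_trans (b := (n : ℝ)) ?_ ?_))
    · exact_mod_cast (hammingDist_le_card_fintype (x := C b) (y := C b')).trans (by simp)
    · nlinarith [Nat.cast_nonneg (α := ℝ) n]
  · obtain ⟨dec, hdec⟩ := hC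
    have h1 := hdec b ⟨0, hk⟩ (C b) (hdist b)
    have h2 := outputLaw_le_one (dec ⟨0, hk⟩) (C b) (b ⟨0, hk⟩)
    linarith
  · by_contra hA
    have : Subsingleton A := Fintype.card_le_one_iff_subsingleton.mp (by omega)
    exact hsub inferInstance
  · by_contra hn
    obtain rfl : n = 0 := by omega
    exact hsub inferInstance

theorem IsLDC.card_pow_three_le {A : Type u} [Fintype A] [DecidableEq A] {k n : ℕ} {δ ε L η : ℝ}
    (hδ : 0 < δ) (hδ1 : δ ≤ 1) (hε : 0 < ε) (a₀ : A) (hn : 0 < n)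
    {C : (Fin k → Bool) → (Fin n → A)} (hC : IsLDC 3 δ ε C) (hL : 1 ≤ L)
    (hη : η = 2 * ε * δ / (3 * (Fintype.card A : ℝ) ^ 3 * (Fintype.card A + 1))) (hη1 : η ≤ 1)
    (hN : (n : ℝ) * (Fintype.card A + 1) ≤ Real.exp L) (hηL : 1 / η ≤ Real.exp L) :
    (k : ℝ) ^ 3 ≤ 10 ^ 27 * (n * (Fintype.card A + 1)) * L ^ 5 / η ^ 10 := by
  have hn0 : (0 : ℝ) < n := by exact_mod_cast hn
  have hA : (0 : ℝ) < Fintype.card A := by exact_mod_cast Fintype.card_pos_iff.mpr ⟨a₀⟩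
  obtain ⟨dec, hdec⟩ := hC
  choose p hp hp1 hlaw using fun i => exists_flat_decoder a₀ (dec i)
  choose B T hB h1 h2 h3 hT using fun i => exists_tensor_of_decoder hn a₀ hδ hδ1 (hp i) (hp1 i)
  have hcard : (Fintype.card (Fin n × Option A) : ℝ) = n * (Fintype.card A + 1) := by simp
  have : Nonempty (Fin n × Option A) := ⟨(⟨0, hn⟩, none)⟩
  have hη0 : 0 < η := by rw [hη]; positivity
  have key := card_pow_three_le_of_signedForm (T := T) ⟨h1, h2, h3⟩ hL hη0 hη1
    (by rw [hcard]; exact hN) hηL (fun b => answerVector (C b)) (fun b => answerVector (C b))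
    (fun b => answerVector (C b)) (fun b => abs_answerVector_le _)
    (fun b => abs_answerVector_le _) (fun b => abs_answerVector_le _) ?_
  · rw [hcard, Fintype.card_fin] at key
    exact key
  · rw [hcard, Fintype.card_fin]
    refine Finset.le_expect Finset.univ_nonempty fun b _ => ?_
    set c : ℝ := δ * n / (3 * (Fintype.card A : ℝ) ^ 3) with hc
    have hc0 : 0 ≤ c := by positivity
    calc η * k * (n * (Fintype.card A + 1)) = ∑ _i : Fin k, c * (2 * ε) := by
          rw [Finset.sum_const, Finset.card_univ, Fintype.card_fin, nsmul_eq_mul, hη, hc]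
          field_simp
      _ ≤ signedForm T b (answerVector (C b)) (answerVector (C b)) (answerVector (C b)) := by
          refine Finset.sum_le_sum fun i _ => ?_
          rw [hT, mul_left_comm (boolSign (b i))]
          refine mul_le_mul_of_nonneg_left ?_ hc0
          have hd := hdec b i (fun v => if v ∈ B i then a₀ else C b v) (by
            refine le_trans ?_ (hB i)
            rw [hammingDist]
            exact_mod_cast Finset.card_le_card fun v hv => by
              by_contra hvB
              simp [hvB] at hv)
          rw [hlaw] at hd
          -- The correlation with the correct sign is `2 Pr[correct] - 1 ≥ 2ε`.
          have e : boolSign (b i) * ∑ f, p i f * boolSign (f.eval a₀ fun v =>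
              if v ∈ B i then a₀ else C b v) = 2 * (∑ f, p i f * (if f.eval a₀ (fun v =>
              if v ∈ B i then a₀ else C b v) = b i then 1 else 0)) - ∑ f, p i f := by
            rw [Finset.mul_sum, Finset.mul_sum, ← Finset.sum_sub_distrib]
            refine Finset.sum_congr rfl fun f _ => ?_
            cases b i <;> cases (f.eval a₀ fun v => if v ∈ B i then a₀ else C b v) <;>
              simp [boolSign] <;> ring
          rw [e, hp1]
          linarith

theorem exists_three_query_bound : ∃ K : ℝ, 0 < K ∧
      ∀ (A : Type u) [Fintype A] [DecidableEq A] (k n : ℕ) (δ ε : ℝ), 0 < δ → 0 < ε →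
        ∀ C : (Fin k → Bool) → (Fin n → A), IsLDC 3 δ ε C →
          (k : ℝ) ^ 3 ≤ (Fintype.card A : ℝ) ^ 41 * (n : ℝ) *
            (K * (Real.log ((Fintype.card A : ℝ) * (n : ℝ)) ^ 6 / (ε ^ 32 * δ ^ 16))) := by
  refine ⟨10 ^ 40, by positivity, ?_⟩
  intro A _ _ k n δ ε hδ hε C hC
  rcases k.eq_zero_or_pos with rfl | hk
  · have : 0 ≤ Real.log ((Fintype.card A : ℝ) * (n : ℝ)) ^ 6 := by positivity
    rw [Nat.cast_zero, zero_pow three_ne_zero]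
    positivity
  obtain ⟨hδ1, hε1, hA, hn⟩ := hC.parameters hk hδ hε
  obtain ⟨a₀⟩ : Nonempty A := Fintype.card_pos_iff.mp (by omega)
  set m : ℝ := (Fintype.card A : ℝ) with hm
  have hm2 : 2 ≤ m := by rw [hm]; exact_mod_cast hA
  have hn1 : (1 : ℝ) ≤ n := by exact_mod_cast hn
  set M : ℝ := m * n with hM
  have hmM : m ≤ M := le_mul_of_one_le_right (by linarith) hn1
  have hM2 : 2 ≤ M := hm2.trans hmM
  set g := Real.log M with hg
  have hg1 : 1 ≤ 2 * g := by
    have := Real.log_le_log (by norm_num) hM2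
    linarith [Real.log_two_gt_d9]
  have hg0 : 0 < g := by linarith
  have hexp : Real.exp g = M := Real.exp_log (by linarith)
  set θ : ℝ := ε * δ with hθ
  have hθ0 : 0 < θ := mul_pos hε hδ
  have hθ1 : θ ≤ 1 := mul_le_one₀ hε1 hδ.le hδ1
  have hθinv : 1 ≤ 1 / θ := (one_le_div hθ0).mpr hθ1
  -- `e^L` must dominate `N` and `1/η`, both polynomial in `M` and `1/θ`. Using `1/θ` in place of
  -- its logarithm keeps `L ≤ 8 g/θ`, at the price of a larger power of `θ`.
  set L : ℝ := 6 * g + 1 / θ with hL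
  have hexpL : Real.exp L = M ^ 6 * Real.exp (1 / θ) := by
    rw [hL, Real.exp_add, ← hexp, ← Real.exp_nat_mul]; norm_num
  have hexpθ : 1 / θ ≤ Real.exp (1 / θ) := by linarith [Real.add_one_le_exp (1 / θ)]
  have hm1 : m + 1 ≤ 3 / 2 * m := by linarith
  set η : ℝ := 2 * ε * δ / (3 * m ^ 3 * (m + 1)) with hη
  have hη0 : 0 < η := by positivity
  have hηinv : 1 / η ≤ 9 / 4 * m ^ 4 / θ := by
    rw [hη, one_div_div, show 2 * ε * δ = 2 * θ by rw [hθ]; ring,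
      div_le_div_iff₀ (by positivity) hθ0]
    have : 3 * m ^ 3 * (m + 1) ≤ 3 * m ^ 3 * (3 / 2 * m) := by gcongr
    nlinarith
  have hη1 : η ≤ 1 := by
    rw [hη, div_le_one (by positivity)]
    have h1 : 1 ≤ m ^ 3 := one_le_pow₀ (by linarith)
    have h2 : 2 * ε * δ = 2 * θ := by rw [hθ]; ring
    nlinarith
  have hN : (n : ℝ) * (m + 1) ≤ Real.exp L := by
    rw [hexpL]
    calc (n : ℝ) * (m + 1) ≤ n * (2 * m) := by gcongr; linarith
      _ = 2 * M * 1 := by rw [hM]; ring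
      _ ≤ M ^ 6 * Real.exp (1 / θ) := by
          gcongr
          · calc 2 * M ≤ M * M := by gcongr
              _ = M ^ 2 := by ring
              _ ≤ M ^ 6 := pow_le_pow_right₀ (by linarith) (by norm_num)
          · linarith
  have hηL : 1 / η ≤ Real.exp L := by
    rw [hexpL]
    refine hηinv.trans ?_
    calc 9 / 4 * m ^ 4 / θ = 9 / 4 * m ^ 4 * (1 / θ) := by ring
      _ ≤ M ^ 6 * Real.exp (1 / θ) := by
          gcongr
          calc 9 / 4 * m ^ 4 ≤ 2 ^ 2 * M ^ 4 := by gcongr; norm_num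
            _ ≤ M ^ 2 * M ^ 4 := by gcongr
            _ = M ^ 6 := by ring
  have hL1 : 1 ≤ L := by rw [hL]; linarith
  have main := hC.card_pow_three_le hδ hδ1 hε a₀ hn hL1 hη hη1 hN hηL
  have hLle : L ≤ 8 * g * (1 / θ) := by
    rw [hL]; nlinarith
  calc (k : ℝ) ^ 3 ≤ 10 ^ 27 * (n * (m + 1)) * L ^ 5 / η ^ 10 := main
    _ = 10 ^ 27 * (n * (m + 1)) * L ^ 5 * (1 / η) ^ 10 := by
        rw [one_div, inv_pow, div_eq_mul_inv]
    -- `m^41` is one factor from `N` and `m^40` from `η^(-10)`; `θ^(-15)` is 5 from `L^5` and 10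
    -- from `η`. The exponents of the statement, and `g^6` in place of `g^5`, only weaken this.
    _ ≤ 10 ^ 27 * (n * (3 / 2 * m)) * (8 * g * (1 / θ)) ^ 5 * (9 / 4 * m ^ 4 / θ) ^ 10 := by
        gcongr
    _ = (10 ^ 27 * (3 / 2) * 8 ^ 5 * (9 / 4) ^ 10) * (m ^ 41 * n) * (g ^ 5 * (1 / θ ^ 15)) := by
        field_simp
    _ ≤ (10 ^ 27 * (3 / 2) * 8 ^ 5 * (9 / 4) ^ 10) * (m ^ 41 * n) *
          ((2 * g ^ 6) * (1 / (ε ^ 32 * δ ^ 16))) := by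
        gcongr
        · nlinarith [pow_pos hg0 5]
        · rw [hθ, mul_pow]
          gcongr ?_ * ?_
          · exact pow_le_pow_of_le_one hε.le hε1 (by norm_num)
          · exact pow_le_pow_of_le_one hδ.le hδ1 (by norm_num)
    _ = (10 ^ 27 * (3 / 2) * 8 ^ 5 * (9 / 4) ^ 10 * 2) * (m ^ 41 * n *
          (g ^ 6 / (ε ^ 32 * δ ^ 16))) := by ring
    _ ≤ 10 ^ 40 * (m ^ 41 * n * (g ^ 6 / (ε ^ 32 * δ ^ 16))) := by
        gcongr; norm_num
    _ = _ := by ring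

theorem mainTheorem2 :
    (∃ K : ℝ, 0 < K ∧
      ∀ (A : Type u) [Fintype A] [DecidableEq A] (k n : ℕ) (δ ε : ℝ), 0 < δ → 0 < ε →
        ∀ C : (Fin k → Bool) → (Fin n → A), IsLDC 3 δ ε C →
          (k : ℝ) ^ 3 ≤ (Fintype.card A : ℝ) ^ 41 * (n : ℝ) *
            (K * (Real.log ((Fintype.card A : ℝ) * (n : ℝ)) ^ 6 / (ε ^ 32 * δ ^ 16)))) ∧
    (∀ δ ε : ℝ, 0 < δ → 0 < ε → ∃ c : ℝ, 0 < c ∧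
      ∀ (A : Type u) [Fintype A] [DecidableEq A] (k n : ℕ), 2 ≤ k → Fintype.card A ≤ n →
        ∀ C : (Fin k → Bool) → (Fin n → A), IsLDC 3 δ ε C →
          c * ((k : ℝ) ^ 3 / ((Fintype.card A : ℝ) ^ 41 * Real.log (k : ℝ) ^ 6)) ≤ (n : ℝ)) := by
  refine ⟨exists_three_query_bound, fun δ ε hδ hε => ?_⟩
  obtain ⟨K, hK, hmain⟩ := exists_three_query_bound.{u}
  -- If `n ≥ k^3`, the constant `1/64` suffices since `log k ≥ 1/2`. Otherwise `|A| n ≤ n^2 ≤ k^6`,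
  -- so the logarithm is at most `6 log k`, whence `6^6`.
  refine ⟨min (1 / 64) (ε ^ 32 * δ ^ 16 / (K * 6 ^ 6)), by positivity, ?_⟩
  intro A _ _ k n hk hAn C hC
  obtain ⟨-, -, hA, hn⟩ := hC.parameters (by omega) hδ hε
  have h := hmain A k n δ ε hδ hε C hC
  set m : ℝ := (Fintype.card A : ℝ) with hm
  have hm2 : 2 ≤ m := by rw [hm]; exact_mod_cast hA
  have hmn : m ≤ n := by rw [hm]; exact_mod_cast hAn
  have hn1 : (1 : ℝ) ≤ n := by exact_mod_cast hn
  have hk2 : (2 : ℝ) ≤ k := by exact_mod_cast hk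
  have hlog : 1 / 2 ≤ Real.log k := by
    have := Real.log_le_log (by norm_num) hk2
    linarith [Real.log_two_gt_d9]
  set g := Real.log (k : ℝ) with hg
  have hg0 : 0 < g := by linarith
  have hm41 : 1 ≤ m ^ 41 := one_le_pow₀ (by linarith)
  rcases le_total ((k : ℝ) ^ 3) n with hkn | hkn
  · calc min (1 / 64) (ε ^ 32 * δ ^ 16 / (K * 6 ^ 6)) * ((k : ℝ) ^ 3 / (m ^ 41 * g ^ 6))
        ≤ 1 / 64 * ((k : ℝ) ^ 3 / (1 * (1 / 2) ^ 6)) := by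
          gcongr
          exact min_le_left _ _
      _ = (k : ℝ) ^ 3 := by ring
      _ ≤ n := hkn
  · have hlogn : Real.log (m * n) ≤ 6 * g := by
      calc Real.log (m * n) ≤ Real.log ((k : ℝ) ^ 6) := by
            refine Real.log_le_log (by positivity) ?_
            calc m * n ≤ (k : ℝ) ^ 3 * (k : ℝ) ^ 3 := by gcongr; exact hmn.trans hkn
              _ = _ := by ring
        _ = 6 * g := by rw [Real.log_pow, ← hg]; norm_num
    have hlog0 : 0 ≤ Real.log (m * n) := Real.log_nonneg (by nlinarith)
    calc min (1 / 64) (ε ^ 32 * δ ^ 16 / (K * 6 ^ 6)) * ((k : ℝ) ^ 3 / (m ^ 41 * g ^ 6))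
        ≤ ε ^ 32 * δ ^ 16 / (K * 6 ^ 6) * (m ^ 41 * n * (K * ((6 * g) ^ 6 / (ε ^ 32 * δ ^ 16))) /
            (m ^ 41 * g ^ 6)) := by
          gcongr
          · exact min_le_right _ _
          · refine h.trans ?_
            gcongr
      _ = (n : ℝ) := by field_simp
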